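/- **Proposition (Morse Lemma for MPOC).** Let $I,J$ be finite index sets, and let $f$, $h_i$ ($i\in I$), $g_j$ ($j\in J$), $F_{1,m},F_{2,m}$ ($m=1,\dots,k$) be real-valued $C^2$ functions on $\mathbb R^n$. Put $$M=\{x\in\mathbb R^n : h_i(x)=0\ (i\in I),\ g_j(x)\ge 0\ (j\in J),\ F_{1,m}(x)F_{2,m}(x)=0,\ F_{2,m}(x)\ge 0\ (m=1,\dots,k)\}.$$ For $\bar x\in M$ let $J_0=\{j: g_j(\bar x)=0\}$, $a_{00}=\{m: F_{1,m}(\bar x)=F_{2,m}(\bar x)=0\}$, $a_{01}=\{m: F_{1,m}(\bar x)=0,\ F_{2,m}(\bar x)>0\}$, $a_{10}=\{m: F_{1,m}(\bar x)\neq 0,\ F_{2,m}(\bar x)=0\}$, and $$s=|I|+|a_{01}|+|a_{10}|,\qquad q=s+|J_0|,\qquad p=n-q-2|a_{00}|.$$ Suppose that $\bar x\in M$ is a nondegenerate T-stationary point with multipliers $\bar\lambda_i$ ($i\in I$), $\bar\mu_j$ ($j\in J_0$), $\bar\sigma_{1,m}$ ($m\in a_{01}$), $\bar\sigma_{2,m}$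 ($m\in a_{10}$), $\bar\varrho_{1,m},\bar\varrho_{2,m}$ ($m\in a_{00}$), that is: * (T-stationarity) $$Df(\bar x)=\sum_{i\in I}\bar\lambda_iDh_i(\bar x)+\sum_{j\in J_0}\bar\mu_jDg_j(\bar x)+\sum_{m\in a_{01}}\bar\sigma_{1,m}DF_{1,m}(\bar x)+\sum_{m\in a_{10}}\bar\sigma_{2,m}DF_{2,m}(\bar x)+\sum_{m\in a_{00}}\bigl(\bar\varrho_{1,m}DF_{1,m}(\bar x)+\bar\varrho_{2,m}DF_{2,m}(\bar x)\bigr),$$ $\bar\mu_j\ge 0$ for all $j\in J_0$, and $\bar\varrho_{1,m}=0$ or $\bar\varrho_{2,m}\le 0$ for all $m\in a_{00}$; * (ND1, LICQ) the vectors $Dh_i(\bar x)$ ($i\in I$), $Dg_j(\bar x)$ ($j\in J_0$), $DF_{1,m}(\bar x)$ ($m\in a_{01}\cup a_{00}$), $DF_{2,m}(\bar x)$ ($m\in a_{10}\cup a_{00}$) are linearly independent; * (ND2) $\bar\mu_j>0$ for all $j\in J_0$; * (ND3) $\bar\varrho_{1,m}\ne 0$ and $\bar\varrho_{2,m}<0$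 for all $m\in a_{00}$; * (ND4) the restriction of $D^2L(\bar x)$ to $T$ is nonsingular, where $$L=f-\sum_{i\in I}\bar\lambda_ih_i-\sum_{j\in J_0}\bar\mu_jg_j-\sum_{m\in a_{01}}\bar\sigma_{1,m}F_{1,m}-\sum_{m\in a_{10}}\bar\sigma_{2,m}F_{2,m}-\sum_{m\in a_{00}}\bigl(\bar\varrho_{1,m}F_{1,m}+\bar\varrho_{2,m}F_{2,m}\bigr)$$ and $T\subseteq\mathbb R^n$ is the common kernel of all the derivatives listed in ND1. Let $QI$ be the number of negative eigenvalues (with multiplicity) of the matrix of $D^2L(\bar x)|_T$ with respect to an orthonormal basis of $T$. Let $\mathbb H=[0,\infty)$ and $\mathbb T=\{(a,b)\in\mathbb R^2: ab=0,\ b\ge 0\}$. Then $q+2|a_{00}|\le n$ (so $p\ge 0$), and there are open neighborhoods $U$ of $\bar x$ and $V$ of $0$ in $\mathbb R^n$ and a $C^1$-diffeomorphism $\Psi:U\to V$ with $\Psi(\bar x)=0$, $$\Psi(M\cap U)=\bigl(\{0\}^s\times\mathbb H^{|J_0|}\times\mathbb T^{|a_{00}|}\times\mathbb R^p\bigr)\cap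 V,$$ and, for a suitable fixed choice of the signs $\pm$, $$f\circ\Psi^{-1}(y)=f(\bar x)+\sum_{j=1}^{|J_0|}y_{s+j}+\sum_{m=1}^{|a_{00}|}\bigl(\pm y_{q+2m-1}-y_{q+2m}\bigr)+\sum_{r=1}^{p}\pm y_{n-p+r}^2$$ for all $y\in\bigl(\{0\}^s\times\mathbb H^{|J_0|}\times\mathbb T^{|a_{00}|}\times\mathbb R^p\bigr)\cap V$, where exactly $QI$ of the $p$ squares carry a negative sign. -/

import Mathlib

/-- Data of a mathematical program with orthogonality type constraints (MPOC) on `ℝⁿ`: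
minimize `f x` subject to `h i x = 0` (`i ∈ I`), `g j x ≥ 0` (`j ∈ J`),
`F₁ m x * F₂ m x = 0` and `F₂ m x ≥ 0` (`m = 1, …, k`), all functions being of class `C²`. -/
structure MPOC (n : ℕ) (I J : Type*) (k : ℕ) where
  f : EuclideanSpace ℝ (Fin n) → ℝ
  h : I → EuclideanSpace ℝ (Fin n) → ℝ
  g : J → EuclideanSpace ℝ (Fin n) → ℝ
  F₁ : Fin k → EuclideanSpace ℝ (Fin n) → ℝ
  F₂ : Fin k → EuclideanSpace ℝ (Fin n) → ℝ
  contDiff_f : ContDiff ℝ 2 f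
  contDiff_h : ∀ i, ContDiff ℝ 2 (h i)
  contDiff_g : ∀ j, ContDiff ℝ 2 (g j)
  contDiff_F₁ : ∀ m, ContDiff ℝ 2 (F₁ m)
  contDiff_F₂ : ∀ m, ContDiff ℝ 2 (F₂ m)

namespace MPOC

/-- The feasible set `M`. -/
def feasibleSet {n k : ℕ} {I J : Type*} (P : MPOC n I J k) : Set (EuclideanSpace ℝ (Fin n)) :=
  {x | (∀ i, P.h i x = 0) ∧ (∀ j, 0 ≤ P.g j x) ∧
    ∀ m, P.F₁ m x * P.F₂ m x = 0 ∧ 0 ≤ P.F₂ m x}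

open Classical in
/-- `J₀(x)`: the active inequality constraints. -/
noncomputable def J₀ {n k : ℕ} {I J : Type*} [Fintype J] (P : MPOC n I J k)
    (x : EuclideanSpace ℝ (Fin n)) : Finset J :=
  {j | P.g j x = 0}

open Classical in
/-- `a₀₀(x)`: the biactive orthogonality type constraints. -/
noncomputable def a₀₀ {n k : ℕ} {I J : Type*} (P : MPOC n I J k)
    (x : EuclideanSpace ℝ (Fin n)) : Finset (Fin k) :=
  {m | P.F₁ m x = 0 ∧ P.F₂ m x = 0}

open Classical in
/-- `a₀₁(x)`. -/
noncomputable def a₀₁ {n k : ℕ} {I J : Type*} (P : MPOC n I J k)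
    (x : EuclideanSpace ℝ (Fin n)) : Finset (Fin k) :=
  {m | P.F₁ m x = 0 ∧ 0 < P.F₂ m x}

open Classical in
/-- `a₁₀(x)`. -/
noncomputable def a₁₀ {n k : ℕ} {I J : Type*} (P : MPOC n I J k)
    (x : EuclideanSpace ℝ (Fin n)) : Finset (Fin k) :=
  {m | P.F₁ m x ≠ 0 ∧ P.F₂ m x = 0}

/-- `s = |I| + |a₀₁(x)| + |a₁₀(x)|`. -/
noncomputable def s {n k : ℕ} {I J : Type*} [Fintype I] (P : MPOC n I J k)
    (x : EuclideanSpace ℝ (Fin n)) : ℕ :=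
  Fintype.card I + (P.a₀₁ x).card + (P.a₁₀ x).card

/-- `q = s + |J₀(x)|`. -/
noncomputable def q {n k : ℕ} {I J : Type*} [Fintype I] [Fintype J] (P : MPOC n I J k)
    (x : EuclideanSpace ℝ (Fin n)) : ℕ :=
  P.s x + (P.J₀ x).card

/-- `p = n - q - 2 |a₀₀(x)|`. Where LICQ holds at a feasible point, `q + 2 |a₀₀(x)| ≤ n`, so the
subtraction of natural numbers is the true one there. -/
noncomputable def p {n k : ℕ} {I J : Type*} [Fintype I] [Fintype J] (P : MPOC n I J k)
    (x : EuclideanSpace ℝ (Fin n)) : ℕ :=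
  n - P.q x - 2 * (P.a₀₀ x).card

/-- MPOC-tailored linear independence constraint qualification at `x`. -/
def LICQ {n k : ℕ} {I J : Type*} [Fintype J] (P : MPOC n I J k)
    (x : EuclideanSpace ℝ (Fin n)) : Prop :=
  LinearIndependent ℝ
    (Sum.elim (fun i : I => fderiv ℝ (P.h i) x)
      (Sum.elim (fun j : P.J₀ x => fderiv ℝ (P.g j) x)
        (Sum.elim
          (fun m : (P.a₀₁ x ∪ P.a₀₀ x : Finset (Fin k)) => fderiv ℝ (P.F₁ m) x)
          (fun m : (P.a₁₀ x ∪ P.a₀₀ x : Finset (Fin k)) => fderiv ℝ (P.F₂ m) x))))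

/-- A system of multipliers at `x`. -/
structure Multipliers {n k : ℕ} {I J : Type*} [Fintype J] (P : MPOC n I J k)
    (x : EuclideanSpace ℝ (Fin n)) where
  lam : I → ℝ
  mu : P.J₀ x → ℝ
  sigma₁ : P.a₀₁ x → ℝ
  sigma₂ : P.a₁₀ x → ℝ
  rho₁ : P.a₀₀ x → ℝ
  rho₂ : P.a₀₀ x → ℝ

/-- `x` is a T-stationary point with multipliers `Λ`. -/
structure IsTStationary {n k : ℕ} {I J : Type*} [Fintype I] [Fintype J] (P : MPOC n I J k)
    (x : EuclideanSpace ℝ (Fin n)) (Λ : P.Multipliers x) : Prop where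
  feasible : x ∈ P.feasibleSet
  stationary : fderiv ℝ P.f x =
    ∑ i, Λ.lam i • fderiv ℝ (P.h i) x
    + ∑ j : P.J₀ x, Λ.mu j • fderiv ℝ (P.g j) x
    + ∑ m : P.a₀₁ x, Λ.sigma₁ m • fderiv ℝ (P.F₁ m) x
    + ∑ m : P.a₁₀ x, Λ.sigma₂ m • fderiv ℝ (P.F₂ m) x
    + ∑ m : P.a₀₀ x,
        (Λ.rho₁ m • fderiv ℝ (P.F₁ m) x + Λ.rho₂ m • fderiv ℝ (P.F₂ m) x)
  mu_nonneg : ∀ j, 0 ≤ Λ.mu j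
  rho_cond : ∀ m, Λ.rho₁ m = 0 ∨ Λ.rho₂ m ≤ 0

/-- The Lagrange function belonging to the multipliers `Λ` at `x`, as a function of `z`. -/
noncomputable def lagrangian {n k : ℕ} {I J : Type*} [Fintype I] [Fintype J] (P : MPOC n I J k)
    (x : EuclideanSpace ℝ (Fin n)) (Λ : P.Multipliers x) (z : EuclideanSpace ℝ (Fin n)) : ℝ :=
  P.f z - ∑ i, Λ.lam i * P.h i z
    - ∑ j : P.J₀ x, Λ.mu j * P.g j z
    - ∑ m : P.a₀₁ x, Λ.sigma₁ m * P.F₁ m z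
    - ∑ m : P.a₁₀ x, Λ.sigma₂ m * P.F₂ m z
    - ∑ m : P.a₀₀ x, (Λ.rho₁ m * P.F₁ m z + Λ.rho₂ m * P.F₂ m z)

/-- The tangent space `T_x M(x)`: the common kernel of the derivatives of all active constraint
functions. -/
def tangentSpace {n k : ℕ} {I J : Type*} [Fintype J] (P : MPOC n I J k)
    (x : EuclideanSpace ℝ (Fin n)) : Submodule ℝ (EuclideanSpace ℝ (Fin n)) where
  carrier := {ξ | (∀ i, fderiv ℝ (P.h i) x ξ = 0) ∧
    (∀ j ∈ P.J₀ x, fderiv ℝ (P.g j) x ξ = 0) ∧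
    (∀ m ∈ P.a₀₁ x, fderiv ℝ (P.F₁ m) x ξ = 0) ∧
    (∀ m ∈ P.a₁₀ x, fderiv ℝ (P.F₂ m) x ξ = 0) ∧
    (∀ m ∈ P.a₀₀ x, fderiv ℝ (P.F₁ m) x ξ = 0 ∧ fderiv ℝ (P.F₂ m) x ξ = 0)}
  add_mem' := by
    rintro a b ⟨h1, h2, h3, h4, h5⟩ ⟨k1, k2, k3, k4, k5⟩
    refine ⟨fun i => ?_, fun j hj => ?_, fun m hm => ?_, fun m hm => ?_, fun m hm => ?_⟩
    · simp [h1 i, k1 i]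
    · simp [h2 j hj, k2 j hj]
    · simp [h3 m hm, k3 m hm]
    · simp [h4 m hm, k4 m hm]
    · simp [h5 m hm, k5 m hm]
  zero_mem' := by simp
  smul_mem' := by
    rintro c a ⟨h1, h2, h3, h4, h5⟩
    refine ⟨fun i => ?_, fun j hj => ?_, fun m hm => ?_, fun m hm => ?_, fun m hm => ?_⟩
    · simp [h1 i]
    · simp [h2 j hj]
    · simp [h3 m hm]
    · simp [h4 m hm]
    · simp [h5 m hm]

/-- The matrix `D²L(x)` restricted to `T_x M(x)`, with respect to an orthonormal basis of the
tangent space. Its determinant and its eigenvalues do not depend on the orthonormal basis. -/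
noncomputable def restrictedHessian {n k : ℕ} {I J : Type*} [Fintype I] [Fintype J]
    (P : MPOC n I J k) (x : EuclideanSpace ℝ (Fin n)) (Λ : P.Multipliers x) :
    Matrix (Fin (Module.finrank ℝ (P.tangentSpace x)))
      (Fin (Module.finrank ℝ (P.tangentSpace x))) ℝ :=
  Matrix.of fun a b =>
    fderiv ℝ (fderiv ℝ (P.lagrangian x Λ)) x
      (stdOrthonormalBasis ℝ (P.tangentSpace x) a : EuclideanSpace ℝ (Fin n))
      (stdOrthonormalBasis ℝ (P.tangentSpace x) b : EuclideanSpace ℝ (Fin n))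

/-- `x` is a nondegenerate T-stationary point with multipliers `Λ`. -/
structure IsNondegenerateTStationary {n k : ℕ} {I J : Type*} [Fintype I] [Fintype J]
    (P : MPOC n I J k) (x : EuclideanSpace ℝ (Fin n)) (Λ : P.Multipliers x) : Prop
    extends P.IsTStationary x Λ where
  licq : P.LICQ x
  mu_pos : ∀ j, 0 < Λ.mu j
  rho_ne : ∀ m, Λ.rho₁ m ≠ 0 ∧ Λ.rho₂ m < 0
  hessian_det_ne : (P.restrictedHessian x Λ).det ≠ 0

/-- The quadratic index `QI`: the number of negative eigenvalues, counted with multiplicity, of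
the restricted Hessian of the Lagrange function. -/
noncomputable def quadraticIndex {n k : ℕ} {I J : Type*} [Fintype I] [Fintype J]
    (P : MPOC n I J k) (x : EuclideanSpace ℝ (Fin n)) (Λ : P.Multipliers x) : ℕ :=
  (P.restrictedHessian x Λ).charpoly.roots.countP (fun μ => μ < 0)

/-- The coordinate of `y ∈ ℝⁿ` with the (zero-based) number `i`; the value `0` for `i ≥ n` is a
convention that keeps index arithmetic free of proof terms. -/
noncomputable def coord {n : ℕ} (y : EuclideanSpace ℝ (Fin n)) (i : ℕ) : ℝ :=
  if hi : i < n then y ⟨i, hi⟩ else 0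

/-- `𝕋 = {(a, b) ∈ ℝ² | a b = 0, b ≥ 0}`. -/
def orthogonalitySet : Set (ℝ × ℝ) := {c | c.1 * c.2 = 0 ∧ 0 ≤ c.2}

/-- The set `{0}ˢ × ℍ^|J₀(x)| × 𝕋^|a₀₀(x)| × ℝᵖ` in `ℝⁿ`. -/
def localModel {n k : ℕ} {I J : Type*} [Fintype I] [Fintype J] (P : MPOC n I J k)
    (x : EuclideanSpace ℝ (Fin n)) : Set (EuclideanSpace ℝ (Fin n)) :=
  {y | (∀ i < P.s x, coord y i = 0) ∧
    (∀ j < (P.J₀ x).card, 0 ≤ coord y (P.s x + j)) ∧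
    (∀ m < (P.a₀₀ x).card,
      (coord y (P.q x + 2 * m), coord y (P.q x + 2 * m + 1)) ∈ orthogonalitySet)}

/-- The normal form with value `c` at the origin, signs `ε` of the linear terms belonging to the
first components of the `𝕋`-factors, and signs `δ` of the squares. -/
noncomputable def normalForm {n k : ℕ} {I J : Type*} [Fintype I] [Fintype J] (P : MPOC n I J k)
    (x : EuclideanSpace ℝ (Fin n)) (c : ℝ) (ε : Fin (P.a₀₀ x).card → ℤˣ) (δ : Fin (P.p x) → ℤˣ)
    (y : EuclideanSpace ℝ (Fin n)) : ℝ :=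
  c + ∑ j : Fin (P.J₀ x).card, coord y (P.s x + j)
    + ∑ m : Fin (P.a₀₀ x).card,
        (((ε m : ℤ) : ℝ) * coord y (P.q x + 2 * m) - coord y (P.q x + 2 * m + 1))
    + ∑ r : Fin (P.p x), ((δ r : ℤ) : ℝ) * coord y (n - P.p x + r) ^ 2

end MPOC

/-!
The proof chooses coordinates in three layers and composes them.

* A chart `Φ` of class `C²` (`exists_adapted_chart`) has the active constraint functions as its
  first coordinates, independent by LICQ, and linear coordinates along an orthonormal eigenbasis of
  the restricted Hessian as its last ones. In this chart the feasible set is the local model. By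
  stationarity the partial derivatives of the objective `f̃ = f ∘ Φ⁻¹` are the multipliers, and since
  the Lagrange function is critical at `x` the Hessian of `f̃` in the last coordinates is the
  restricted Hessian, now diagonal.

* On the subspace where the coordinates of the equality type vanish, `f̃` is the sum of its
  restriction to the last coordinates and of its increments along the path that switches on the
  coordinates of the inequality and orthogonality type one by one. As the corresponding multipliers
  do not vanish, each increment has, up to a fixed sign, the sign of the coordinate that is switched
  on. Hence the increments are new coordinates (`exists_increment_coordinates`) in which `f̃` is
  linear, and this change preserves `{0}ˢ × ℍ × 𝕋 × ℝᵖ`, a set described by signs of coordinates.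

* The restriction of `f̃` to the last coordinates is of class `C²` only, so that the usual
  integral remainder would lose too much regularity for a change of coordinates of class `C¹`. With
  the Taylor expansion `∑ dᵢ wᵢ² + r(w)` one takes instead `yᵢ = wᵢ √|dᵢ + r(w) / |w|²|`
  (`exists_morse_coordinates`). Then `∑ sign(dᵢ) yᵢ² = ∑ dᵢ wᵢ² + r(w)`. The quotient
  `r(w) / |w|²` need not be differentiable at the origin, but `r = o(|w|²)` and `Dr = o(|w|)` make
  the products `yᵢ` continuously differentiable there (`contDiffAt_mul_comp_div_norm_sq`).

The composite has an invertible derivative at `x`, and the inverse function theorem yields `Ψ`.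
-/

open Filter Topology Asymptotics

/-! ### The inverse function theorem and a quotient of order zero -/

/-- The inverse function theorem in finite dimension with regularity on both sides: a map of class
`C^m` with injective derivative at `x` restricts to a diffeomorphism of class `C^m` whose source is
a neighbourhood of `x` inside a prescribed one. -/
theorem exists_openPartialHomeomorph_of_injective {E : Type*} [NormedAddCommGroup E]
    [NormedSpace ℝ E] [FiniteDimensional ℝ E] {F : E → E} {F' : E →L[ℝ] E} {x : E}
    {m : WithTop ℕ∞} (hm : m ≠ 0) (hm' : m ≠ ((⊤ : ℕ∞) : WithTop ℕ∞))
    (hF : ContDiffAt ℝ m F x)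
    (hF' : HasFDerivAt F F' x) (hinj : Function.Injective F') {U : Set E} (hU : U ∈ 𝓝 x) :
    ∃ Ψ : OpenPartialHomeomorph E E, (∀ z, Ψ z = F z) ∧ x ∈ Ψ.source ∧ Ψ.source ⊆ U ∧
      ContDiffOn ℝ m Ψ Ψ.source ∧ ContDiffOn ℝ m Ψ.symm Ψ.target := by
  have : CompleteSpace E := FiniteDimensional.complete ℝ E
  let L : E ≃L[ℝ] E := (LinearEquiv.ofInjectiveEndo (F' : E →ₗ[ℝ] E) hinj).toContinuousLinearEquiv
  have hL : (L : E →L[ℝ] E) = F' := by ext v; rfl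
  rw [← hL] at hF'
  let Ψ₀ := hF.toOpenPartialHomeomorph F hF' hm
  have hco : (Ψ₀ : E → E) = F := ContDiffAt.toOpenPartialHomeomorph_coe hF hF' hm
  have hx₀ : x ∈ Ψ₀.source := ContDiffAt.mem_toOpenPartialHomeomorph_source hF hF' hm
  have hsymm : ContDiffAt ℝ m Ψ₀.symm (Ψ₀ x) := by
    rw [hco]; exact hF.to_localInverse hF' hm
  have h1 : ∀ᶠ z in 𝓝 x, ContDiffAt ℝ m F z := hF.eventually hm'
  have h2 : ∀ᶠ z in 𝓝 x, ContDiffAt ℝ m Ψ₀.symm (Ψ₀ z) :=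
    (Ψ₀.continuousAt hx₀).eventually (hsymm.eventually hm')
  obtain ⟨V, hV, hVo, hxV⟩ := eventually_nhds_iff.1 (h1.and (h2.and hU))
  refine ⟨Ψ₀.restrOpen V hVo, fun z => by simp [hco], by simp [hx₀, hxV], ?_, ?_, ?_⟩
  · intro z hz
    exact (hV z (by simpa using hz.2)).2.2
  · intro z hz
    have := (hV z (by simpa using hz.2)).1
    simpa [hco] using this.contDiffWithinAt
  · intro y hy
    have hy1 : y ∈ Ψ₀.target := by
      have := hy
      simp at this
      exact this.1
    have hy2 : Ψ₀.symm y ∈ V := by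
      have := hy
      simp at this
      exact this.2
    have := (hV _ hy2).2.1
    rw [Ψ₀.right_inv hy1] at this
    simpa using this.contDiffWithinAt

theorem isLittleO_norm_sq_of_fderiv {E : Type*} [NormedAddCommGroup E] [NormedSpace ℝ E]
    {r : E → ℝ} (hr : ∀ᶠ z in 𝓝 0, DifferentiableAt ℝ r z) (h0 : r 0 = 0)
    (hd : (fun z => fderiv ℝ r z) =o[𝓝 0] (fun z : E => z)) :
    r =o[𝓝 0] (fun z : E => ‖z‖ ^ 2) := by
  rw [isLittleO_iff] at hd ⊢
  intro c hc
  obtain ⟨δ, hδ, hball⟩ := Metric.eventually_nhds_iff_ball.1 (hr.and (hd hc))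
  filter_upwards [Metric.ball_mem_nhds (0 : E) hδ] with z hz
  have hsub : ∀ w ∈ Metric.closedBall (0 : E) ‖z‖, w ∈ Metric.ball (0 : E) δ := by
    intro w hw
    simp only [Metric.mem_closedBall, Metric.mem_ball, dist_zero_right] at *
    linarith
  have := Convex.norm_image_sub_le_of_norm_fderiv_le (𝕜 := ℝ) (f := r) (C := c * ‖z‖)
    (s := Metric.closedBall (0 : E) ‖z‖) (x := 0) (y := z)
    (fun w hw => (hball w (hsub w hw)).1)
    (fun w hw => ((hball w (hsub w hw)).2).trans
      (mul_le_mul_of_nonneg_left (by simpa using hw) hc.le))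
    (convex_closedBall _ _) (by simp) (by simp)
  rw [h0, sub_zero, sub_zero] at this
  rw [norm_pow, norm_norm]
  linarith [this, sq (‖z‖), mul_assoc c ‖z‖ ‖z‖]

/-- If `r` is of class `C²` and vanishes to second order at the origin, then `r z / ‖z‖²` tends to
zero and its derivative is `o(1 / ‖z‖)`. A linear factor therefore compensates the missing
regularity of the quotient at the origin, where the junk value `r 0 / 0 = 0` is the limit. -/
theorem contDiffAt_mul_comp_div_norm_sq {E : Type*} [NormedAddCommGroup E] [InnerProductSpace ℝ E]
    {r : E → ℝ} (hr : ContDiffAt ℝ 2 r 0) (h0 : r 0 = 0) (h1 : fderiv ℝ r 0 = 0)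
    (h2 : fderiv ℝ (fderiv ℝ r) 0 = 0) {ψ : ℝ → ℝ} (hψ : ContDiffAt ℝ 1 ψ 0) (l : E →L[ℝ] ℝ) :
    ContDiffAt ℝ 1 (fun z => l z * ψ (r z / ‖z‖ ^ 2)) 0 ∧
      HasFDerivAt (fun z => l z * ψ (r z / ‖z‖ ^ 2)) (ψ 0 • l) 0 := by
  have hfd : ContDiffAt ℝ 1 (fderiv ℝ r) 0 := hr.fderiv_right (by norm_num [one_add_one_eq_two])
  have hd : (fun z => fderiv ℝ r z) =o[𝓝 0] (fun z : E => z) := by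
    have := (hfd.differentiableAt (by norm_num)).hasFDerivAt.isLittleO
    simpa [h1, h2] using this
  have hr1 : ∀ᶠ z in 𝓝 (0 : E), ContDiffAt ℝ 2 r z := hr.eventually (by decide)
  have hrd : ∀ᶠ z in 𝓝 (0 : E), DifferentiableAt ℝ r z :=
    hr1.mono fun z hz => hz.differentiableAt (by norm_num)
  have hro := isLittleO_norm_sq_of_fderiv hrd h0 hd
  have hρ : Tendsto (fun z : E => r z / ‖z‖ ^ 2) (𝓝 0) (𝓝 0) := hro.tendsto_div_nhds_zero
  have hψ1 : ∀ᶠ t in 𝓝 (0 : ℝ), ContDiffAt ℝ 1 ψ t := hψ.eventually (by decide)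
  have hψd : ∀ᶠ t in 𝓝 (0 : ℝ), ContinuousAt (deriv ψ) t := by
    filter_upwards [hψ1] with t ht
    have : ContDiffAt ℝ 0 (fderiv ℝ ψ) t := ht.fderiv_right (by norm_num)
    have := this.continuousAt
    change ContinuousAt (fun t => fderiv ℝ ψ t 1) t
    exact this.clm_apply continuousAt_const
  -- the derivative; the formula also holds at the origin, where `l z = 0` kills the second summand
  let κ' : E → E →L[ℝ] ℝ := fun z => ψ (r z / ‖z‖ ^ 2) • l +
    (l z * deriv ψ (r z / ‖z‖ ^ 2)) •
      ((‖z‖ ^ 2)⁻¹ • fderiv ℝ r z - (2 * r z / (‖z‖ ^ 2) ^ 2) • innerSL ℝ z)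
  have hκ'0 : κ' 0 = ψ 0 • l := by simp [κ']
  have hat0 : HasFDerivAt (fun z => l z * ψ (r z / ‖z‖ ^ 2)) (ψ 0 • l) 0 := by
    rw [hasFDerivAt_iff_isLittleO]
    have hψ0 : (fun z : E => ψ (r z / ‖z‖ ^ 2) - ψ 0) =o[𝓝 0] (fun _ => (1 : ℝ)) := by
      rw [isLittleO_one_iff]
      have := (hψ.continuousAt.tendsto.comp hρ).sub_const (ψ 0)
      simpa using this
    have hl : (fun z : E => l z) =O[𝓝 0] (fun z => z) := l.isBigO_id _
    have := (hl.norm_right.mul_isLittleO hψ0)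
    rw [← isLittleO_norm_right]
    refine (this.congr_left ?_).congr_right ?_
    · intro z; simp; ring
    · intro z; simp
  -- away from the origin the product rule applies
  have hat : ∀ᶠ z in 𝓝 (0 : E), HasFDerivAt (fun z => l z * ψ (r z / ‖z‖ ^ 2)) (κ' z) z := by
    filter_upwards [hrd, hρ.eventually hψ1] with z hz hz'
    by_cases hz0 : z = 0
    · subst hz0; rw [hκ'0]; exact hat0
    have hn : ‖z‖ ^ 2 ≠ 0 := by simpa using hz0
    have e1 : HasFDerivAt (fun z : E => ‖z‖ ^ 2) (2 • innerSL ℝ z) z := by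
      simpa using (hasFDerivAt_id z).norm_sq
    have e2 := (hasDerivAt_inv hn).comp_hasFDerivAt z e1
    have e3 := hz.hasFDerivAt.mul e2
    have e4 := (hz'.differentiableAt (by norm_num)).hasDerivAt
    have e5 := HasDerivAt.comp_hasFDerivAt (h₂ := ψ) (f := fun z => r z / ‖z‖ ^ 2) z e4
      (e3.congr_of_eventuallyEq (Eventually.of_forall fun w => by simp [div_eq_mul_inv]))
    have e6 := l.hasFDerivAt (x := z) |>.mul e5
    refine e6.congr_fderiv ?_
    ext v
    simp [κ']
    field_simp
    ring
  have hcont0 : ContinuousAt κ' 0 := by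
    rw [ContinuousAt, hκ'0]
    have t1 : Tendsto (fun z : E => ψ (r z / ‖z‖ ^ 2) • l) (𝓝 0) (𝓝 (ψ 0 • l)) :=
      (hψ.continuousAt.tendsto.comp hρ).smul_const l
    have t2 : Tendsto (fun z : E => (l z * deriv ψ (r z / ‖z‖ ^ 2)) •
      ((‖z‖ ^ 2)⁻¹ • fderiv ℝ r z - (2 * r z / (‖z‖ ^ 2) ^ 2) • innerSL ℝ z)) (𝓝 0) (𝓝 0) := by
      rw [← isLittleO_one_iff ℝ]
      have b1 : (fun z : E => l z) =O[𝓝 0] (fun z => ‖z‖) := (l.isBigO_id _).norm_right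
      have b2 : (fun z : E => deriv ψ (r z / ‖z‖ ^ 2)) =O[𝓝 0] (fun _ => (1 : ℝ)) :=
        (hψd.self_of_nhds.tendsto.comp hρ).isBigO_one ℝ
      have b3 : (fun z : E => (‖z‖ ^ 2)⁻¹ • fderiv ℝ r z) =o[𝓝 0] (fun z => ‖z‖⁻¹) := by
        have := (isBigO_refl (fun z : E => (‖z‖ ^ 2)⁻¹) (𝓝 0)).smul_isLittleO hd.norm_right
        refine this.congr_right fun z => ?_
        by_cases hz : ‖z‖ = 0
        · simp [hz]
        · simp; field_simp
      have b4 : (fun z : E => (2 * r z / (‖z‖ ^ 2) ^ 2) • innerSL ℝ z) =o[𝓝 0]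
          (fun z => ‖z‖⁻¹) := by
        have i1 : (fun z : E => innerSL ℝ z) =O[𝓝 0] (fun z : E => ‖z‖) :=
          ((innerSL ℝ (E := E)).isBigO_id (𝓝 0)).norm_right
        have i2 := (isBigO_refl (fun z : E => 2 * ((‖z‖ ^ 2) ^ 2)⁻¹) (𝓝 0)).mul_isLittleO hro
        have i3 := i2.smul_isBigO i1
        refine (i3.congr_left fun z => ?_).trans_isBigO ?_
        · congr 1; ring
        · refine IsBigO.of_bound 2 (Eventually.of_forall fun z => ?_)
          by_cases hz : ‖z‖ = 0
          · simp [hz]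
          · simp; field_simp; norm_num
      have b5 := (b1.mul b2).smul_isLittleO (b3.sub b4)
      refine b5.trans_isBigO (IsBigO.of_bound 1 (Eventually.of_forall fun z => ?_))
      by_cases hz : ‖z‖ = 0
      · simp [hz]
      · simp [hz]
    simpa using t1.add t2
  have hcont : ∀ᶠ z in 𝓝 (0 : E), ContinuousAt κ' z := by
    filter_upwards [hr1, hρ.eventually hψ1, hρ.eventually hψd] with z hz hz' hz''
    by_cases hz0 : z = 0
    · subst hz0; exact hcont0
    have hn : ‖z‖ ^ 2 ≠ 0 := by simpa using hz0
    have c0 : ContinuousAt (fun z : E => ‖z‖ ^ 2) z := by fun_prop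
    have c1 : ContinuousAt (fun z => r z / ‖z‖ ^ 2) z := hz.continuousAt.div c0 hn
    have c2 : ContinuousAt (fderiv ℝ r) z :=
      (hz.fderiv_right (m := 0) (by norm_num)).continuousAt
    have c3 : ContinuousAt (fun z => ψ (r z / ‖z‖ ^ 2)) z :=
      ContinuousAt.comp (g := ψ) (f := fun z => r z / ‖z‖ ^ 2) hz'.continuousAt c1
    have c4 : ContinuousAt (fun z => deriv ψ (r z / ‖z‖ ^ 2)) z :=
      ContinuousAt.comp (g := deriv ψ) (f := fun z => r z / ‖z‖ ^ 2) hz'' c1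
    have c5 : ContinuousAt (fun z : E => innerSL ℝ z) z := (innerSL ℝ).continuous.continuousAt
    exact (c3.smul continuousAt_const).add ((l.continuous.continuousAt.mul c4).smul
      (((c0.inv₀ hn).smul c2).sub
        (((continuousAt_const.mul hz.continuousAt).div (c0.pow 2) (pow_ne_zero 2 hn)).smul c5)))
  refine ⟨?_, hat0⟩
  rw [contDiffAt_one_iff]
  exact ⟨κ', _, hcont.and hat, fun z hz => hz.1.continuousWithinAt, fun z hz => hz.2⟩

/-! ### Straightening a function in coordinates -/

/-- The coordinate projection of `ℝ^ι` that keeps the coordinates in `S` and sets the other ones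
to zero. -/
noncomputable def coordProj {ι : Type*} [Fintype ι] [DecidableEq ι] (S : Finset ι) :
    EuclideanSpace ℝ ι →L[ℝ] EuclideanSpace ℝ ι :=
  ∑ i ∈ S, (EuclideanSpace.proj i : EuclideanSpace ℝ ι →L[ℝ] ℝ).smulRight
    (EuclideanSpace.single i (1 : ℝ))

theorem coordProj_apply {ι : Type*} [Fintype ι] [DecidableEq ι] (S : Finset ι)
    (z : EuclideanSpace ℝ ι) (j : ι) : coordProj S z j = if j ∈ S then z j else 0 := by
  simp [coordProj, Pi.single_apply]

theorem coordProj_eq_self {ι : Type*} [Fintype ι] [DecidableEq ι] {S : Finset ι}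
    {z : EuclideanSpace ℝ ι} (hz : ∀ i ∉ S, z i = 0) : coordProj S z = z := by
  ext j
  rw [coordProj_apply]
  split_ifs with h
  · rfl
  · exact (hz j h).symm

theorem sign_eq_of_abs_sub_le {a b : ℝ} (h : |a - b| ≤ |b| / 2) :
    SignType.sign a = SignType.sign b := by
  have h' := abs_le.1 h
  rcases lt_trichotomy b 0 with hb | rfl | hb
  · rw [abs_of_neg hb] at h'
    rw [sign_neg hb, sign_neg (by linarith)]
  · simp at h
    rw [h]
  · rw [abs_of_pos hb] at h'
    rw [sign_pos hb, sign_pos (by linarith)]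

/-- A function with strict derivative `f'` at `x` is, near `x`, strictly monotone along all segments
in a direction `v` with `f' v ≠ 0`. -/
theorem HasStrictFDerivAt.eventually_sign_sub {E : Type*} [NormedAddCommGroup E]
    [NormedSpace ℝ E] {f : E → ℝ} {f' : E →L[ℝ] ℝ} {x v : E} (hf : HasStrictFDerivAt f f' x)
    (hv : f' v ≠ 0) :
    ∀ᶠ p in 𝓝 (x, x), ∀ t : ℝ, p.1 - p.2 = t • v →
      SignType.sign (f p.1 - f p.2) = SignType.sign (f' v) * SignType.sign t := by
  have hv0 : 0 < ‖v‖ := norm_pos_iff.2 fun h => hv (by simp [h])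
  have hc : 0 < |f' v| / (2 * ‖v‖) := by have := abs_pos.2 hv; positivity
  filter_upwards [isLittleO_iff.1 hf.isLittleO hc] with p hp t ht
  rw [← sign_mul, mul_comm]
  apply sign_eq_of_abs_sub_le
  rw [ht, map_smul, norm_smul, smul_eq_mul, Real.norm_eq_abs, Real.norm_eq_abs] at hp
  refine hp.trans (le_of_eq ?_)
  rw [abs_mul]
  field_simp

/-- Coordinates straightening a function in the directions in which its derivative does not
vanish. The new coordinates are the increments of `f` along the path that switches on the
coordinates in `A` one after the other; they add up to the increment of `f`. -/
theorem exists_increment_coordinates {n : ℕ} (A W : Finset (Fin n)) (hAW : Disjoint A W)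
    {f : EuclideanSpace ℝ (Fin n) → ℝ} (hf : ContDiffAt ℝ 1 f 0)
    (hA : ∀ i ∈ A, fderiv ℝ f 0 (EuclideanSpace.single i 1) ≠ 0) :
    ∃ Δ : Fin n → EuclideanSpace ℝ (Fin n) → ℝ,
      (∀ i ∈ A, Δ i 0 = 0 ∧ ContDiffAt ℝ 1 (Δ i) 0 ∧
        HasFDerivAt (Δ i) (fderiv ℝ f 0 (EuclideanSpace.single i 1) •
          (EuclideanSpace.proj i : EuclideanSpace ℝ (Fin n) →L[ℝ] ℝ)) 0 ∧
        ∀ᶠ z in 𝓝 0, SignType.sign (Δ i z) =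
          SignType.sign (fderiv ℝ f 0 (EuclideanSpace.single i 1)) * SignType.sign (z i)) ∧
      ∀ z, ∑ i ∈ A, Δ i z = f (coordProj (A ∪ W) z) - f (coordProj W z) := by
  classical
  -- the coordinates switched on after `l` steps; steps belonging to indices outside `A` are idle
  let S : ℕ → Finset (Fin n) := fun l => A.filter (fun i => (i : ℕ) < l) ∪ W
  let Δ : ℕ → EuclideanSpace ℝ (Fin n) → ℝ := fun l z =>
    f (coordProj (S (l + 1)) z) - f (coordProj (S l) z)
  have hcd : ∀ l, ContDiffAt ℝ 1 (fun z => f (coordProj (S l) z)) 0 := fun l => by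
    have h0 : ContDiffAt ℝ 1 f (coordProj (S l) 0) := by simpa using hf
    exact h0.comp (0 : EuclideanSpace ℝ (Fin n)) (coordProj (S l)).contDiff.contDiffAt
  have hder : ∀ l, HasFDerivAt (fun z => f (coordProj (S l) z))
      ((fderiv ℝ f 0).comp (coordProj (S l))) 0 := fun l => by
    have h0 : HasFDerivAt f (fderiv ℝ f 0) (coordProj (S l) 0) := by
      simpa using (hf.differentiableAt (by norm_num)).hasFDerivAt
    exact h0.comp (0 : EuclideanSpace ℝ (Fin n)) (coordProj (S l)).hasFDerivAt
  have hstep : ∀ i ∈ A, ∀ z, coordProj (S (i + 1)) z - coordProj (S i) z =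
      z i • EuclideanSpace.single i (1 : ℝ) := by
    intro i hi z
    have hiW : i ∉ W := Finset.disjoint_left.1 hAW hi
    ext j
    simp only [PiLp.sub_apply, coordProj_apply, PiLp.smul_apply, PiLp.single_apply, S,
      Finset.mem_union, Finset.mem_filter]
    by_cases hij : j = i
    · subst hij
      simp [hi, hiW]
    · have : ((j : ℕ) < i + 1) ↔ (j : ℕ) < i := by
        have : (j : ℕ) ≠ i := fun h => hij (Fin.ext h)
        omega
      simp [this, hij]
  have hzero : ∀ i : Fin n, i ∉ A → ∀ z, Δ i z = 0 := by
    intro i hi z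
    have : S (i + 1) = S i := by
      ext j
      simp only [S, Finset.mem_union, Finset.mem_filter]
      have : j ∈ A → (((j : ℕ) < i + 1) ↔ (j : ℕ) < i) := fun hj => by
        have : (j : ℕ) ≠ i := fun h => hi (Fin.ext h ▸ hj)
        omega
      tauto
    simp [Δ, this]
  refine ⟨fun i => Δ i, fun i hi => ⟨by simp [Δ], (hcd _).sub (hcd _), ?_, ?_⟩, fun z => ?_⟩
  · refine ((hder (i + 1)).sub (hder i)).congr_fderiv ?_
    ext z
    simp only [sub_apply, ContinuousLinearMap.comp_apply, ← map_sub,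
      hstep i hi z, map_smul]
    simp [mul_comm]
  · have hs := (hf.hasStrictFDerivAt (by norm_num)).eventually_sign_sub (hA i hi)
    have ht : Tendsto (fun z => (coordProj (S (i + 1)) z, coordProj (S i) z)) (𝓝 0)
        (𝓝 ((0 : EuclideanSpace ℝ (Fin n)), (0 : EuclideanSpace ℝ (Fin n)))) := by
      have : ContinuousAt (fun z => (coordProj (S (i + 1)) z, coordProj (S i) z)) 0 := by
        fun_prop
      simpa [ContinuousAt] using this
    filter_upwards [ht.eventually hs] with z hz
    exact hz _ (hstep i hi z)
  · have h1 : ∑ i ∈ A, Δ i z = ∑ i : Fin n, Δ i z :=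
      Finset.sum_subset (Finset.subset_univ A) fun i _ hi => hzero i hi z
    have hSn : S n = A ∪ W := by
      simp [S]
    have hS0 : S 0 = W := by simp [S]
    rw [h1, Fin.sum_univ_eq_sum_range (fun l => Δ l z),
      Finset.sum_range_sub (fun l => f (coordProj (S l) z)), hSn, hS0]

/-- The Morse lemma for a function of class `C²`, with a change of coordinates of class `C¹`, in
the form of coordinate functions depending on the coordinates in `W` only. If `r` denotes the
remainder of the second order Taylor expansion `f 0 + ∑ dᵢ wᵢ² + r(w)`, the new coordinates are
`wᵢ √|dᵢ + r(w) / |w|²|`. -/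
theorem exists_morse_coordinates {ι : Type*} [Fintype ι] [DecidableEq ι] (W : Finset ι)
    {f : EuclideanSpace ℝ ι → ℝ} (hf : ContDiffAt ℝ 2 f 0)
    (hW : ∀ i ∈ W, fderiv ℝ f 0 (EuclideanSpace.single i 1) = 0) (d : ι → ℝ)
    (hd : ∀ i ∈ W, d i ≠ 0)
    (hess : ∀ i ∈ W, ∀ j ∈ W, fderiv ℝ (fderiv ℝ f) 0 (EuclideanSpace.single i 1)
      (EuclideanSpace.single j 1) = if i = j then 2 * d i else 0) :
    ∃ κ : ι → EuclideanSpace ℝ ι → ℝ,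
      (∀ i ∈ W, κ i 0 = 0 ∧ ContDiffAt ℝ 1 (κ i) 0 ∧
        ∃ c : ℝ, c ≠ 0 ∧
          HasFDerivAt (κ i) (c • (EuclideanSpace.proj i : EuclideanSpace ℝ ι →L[ℝ] ℝ)) 0) ∧
      ∀ᶠ z in 𝓝 0, f (coordProj W z) =
        f 0 + ∑ i ∈ W, (SignType.sign (d i) : ℝ) * κ i z ^ 2 := by
  let π : EuclideanSpace ℝ ι →L[ℝ] EuclideanSpace ℝ ι := coordProj W
  let pr : ι → EuclideanSpace ℝ ι →L[ℝ] ℝ := fun i => EuclideanSpace.proj i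
  let r : EuclideanSpace ℝ ι → ℝ := fun z => f (π z) - f 0 - ∑ i ∈ W, d i * pr i z ^ 2
  have hπ0 : π 0 = 0 := map_zero _
  have hfπ : ContDiffAt ℝ 2 f (π 0) := by rwa [hπ0]
  have hexp : ∀ v, π v = ∑ i ∈ W, v i • EuclideanSpace.single i (1 : ℝ) := by
    intro v; simp [π, coordProj]
  have hr : ContDiffAt ℝ 2 r 0 := by
    refine ((hfπ.comp (0 : EuclideanSpace ℝ ι) π.contDiff.contDiffAt).sub contDiffAt_const).sub ?_
    exact ContDiffAt.sum fun i _ => contDiffAt_const.mul ((pr i).contDiff.contDiffAt.pow 2)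
  have hr0 : r 0 = 0 := by simp [r]
  have hr' : ∀ᶠ z in 𝓝 (0 : EuclideanSpace ℝ ι),
      fderiv ℝ r z = (fderiv ℝ f (π z)).comp π - ∑ i ∈ W, (2 * d i * pr i z) • pr i := by
    have : ∀ᶠ z in 𝓝 (0 : EuclideanSpace ℝ ι), ContDiffAt ℝ 2 f (π z) :=
      π.continuous.continuousAt.eventually (hfπ.eventually (by decide))
    filter_upwards [this] with z hz
    have h1 : HasFDerivAt (fun z => f (π z)) ((fderiv ℝ f (π z)).comp π) z :=
      (hz.differentiableAt (by norm_num)).hasFDerivAt.comp z π.hasFDerivAt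
    have h2 : HasFDerivAt (fun z => ∑ i ∈ W, d i * pr i z ^ 2)
        (∑ i ∈ W, (2 * d i * pr i z) • pr i) z := by
      refine HasFDerivAt.fun_sum fun i _ => ?_
      refine (((pr i).hasFDerivAt.pow 2).const_mul (d i)).congr_fderiv ?_
      ext v
      simp
      ring
    exact ((h1.sub_const _).sub h2).fderiv
  have hr1 : fderiv ℝ r 0 = 0 := by
    rw [hr'.self_of_nhds]
    ext v
    simp only [hπ0, map_zero, mul_zero, zero_smul, Finset.sum_const_zero, sub_zero,
      ContinuousLinearMap.comp_apply, zero_apply]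
    rw [hexp, map_sum]
    exact Finset.sum_eq_zero fun i hi => by rw [map_smul, hW i hi, smul_zero]
  have hr2 : fderiv ℝ (fderiv ℝ r) 0 = 0 := by
    have hfd : HasFDerivAt (fderiv ℝ f) (fderiv ℝ (fderiv ℝ f) 0) (π 0) := by
      rw [hπ0]
      exact ((hf.fderiv_right (m := 1) (by norm_num [one_add_one_eq_two])).differentiableAt
        (by norm_num)).hasFDerivAt
    have h1 := (hfd.comp (0 : EuclideanSpace ℝ ι) π.hasFDerivAt).clm_comp
      (hasFDerivAt_const π (0 : EuclideanSpace ℝ ι))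
    have h2 : HasFDerivAt (fun z => ∑ i ∈ W, (2 * d i * pr i z) • pr i)
        (∑ i ∈ W, ((2 * d i) • pr i).smulRight (pr i)) 0 :=
      HasFDerivAt.fun_sum fun i _ => (((pr i).hasFDerivAt.const_mul (2 * d i))).smul_const (pr i)
    have h3 := (h1.sub h2).congr_of_eventuallyEq hr'
    rw [h3.fderiv]
    ext v w
    simp only [sub_apply, add_apply,
      ContinuousLinearMap.comp_apply, zero_apply, map_zero, zero_add,
      ContinuousLinearMap.flip_apply, ContinuousLinearMap.compL_apply,
      sum_apply, ContinuousLinearMap.smulRight_apply,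
      smul_apply, smul_eq_mul]
    rw [hexp v, hexp w]
    simp only [map_sum, map_smul, sum_apply, smul_apply,
      smul_eq_mul]
    rw [sub_eq_zero]
    refine Finset.sum_congr rfl fun i hi => ?_
    rw [Finset.sum_eq_single i]
    · rw [hess i hi i hi, if_pos rfl]; simp [pr]; ring
    · intro j hj hji; rw [hess j hj i hi, if_neg hji]; simp
    · exact fun h => absurd hi h
  -- `dᵢ ≠ 0` keeps the argument of the root away from zero, whatever the sign of `dᵢ`
  let ψ : ι → ℝ → ℝ := fun i t => √|d i + t|
  have hψ : ∀ i ∈ W, ContDiffAt ℝ 1 (ψ i) 0 := fun i hi => by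
    have hi' : d i + 0 ≠ 0 := by simpa using hd i hi
    exact ((contDiffAt_abs hi').comp (0 : ℝ) (contDiffAt_const.add contDiffAt_id)).sqrt
      (by simpa using hd i hi)
  let κ₀ : ι → EuclideanSpace ℝ ι → ℝ := fun i z => pr i z * ψ i (r z / ‖z‖ ^ 2)
  have hκ₀ := fun i hi => contDiffAt_mul_comp_div_norm_sq hr hr0 hr1 hr2 (hψ i hi) (pr i)
  refine ⟨fun i z => κ₀ i (π z), fun i hi => ⟨by simp [κ₀], ?_, ψ i 0, ?_, ?_⟩, ?_⟩
  · have : ContDiffAt ℝ 1 (κ₀ i) (π 0) := by rw [hπ0]; exact (hκ₀ i hi).1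
    exact this.comp (0 : EuclideanSpace ℝ ι) π.contDiff.contDiffAt
  · simpa [ψ] using Real.sqrt_ne_zero'.2 (abs_pos.2 (hd i hi))
  · have : HasFDerivAt (κ₀ i) (ψ i 0 • pr i) (π 0) := by rw [hπ0]; exact (hκ₀ i hi).2
    refine (this.comp (0 : EuclideanSpace ℝ ι) π.hasFDerivAt).congr_fderiv ?_
    ext v
    simp [pr, π, coordProj_apply, hi]
  · have hρ : Tendsto (fun z => r (π z) / ‖π z‖ ^ 2) (𝓝 0) (𝓝 0) := by
      have hro := isLittleO_norm_sq_of_fderiv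
        ((hr.eventually (by decide)).mono fun z hz => hz.differentiableAt (by norm_num)) hr0
        (by
          have := ((hr.fderiv_right (m := 1) (by norm_num [one_add_one_eq_two])).differentiableAt
            (by norm_num)).hasFDerivAt.isLittleO
          simpa [hr1, hr2] using this)
      have hc : Tendsto π (𝓝 0) (𝓝 0) := by simpa using π.continuous.tendsto 0
      exact hro.tendsto_div_nhds_zero.comp hc
    have hsgn : ∀ᶠ z in 𝓝 (0 : EuclideanSpace ℝ ι), ∀ i ∈ W,
        (SignType.sign (d i) : ℝ) * |d i + r (π z) / ‖π z‖ ^ 2| =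
          d i + r (π z) / ‖π z‖ ^ 2 := by
      rw [Filter.eventually_all_finset]
      intro i hi
      have hpos : 0 < |d i| / 2 := by have := abs_pos.2 (hd i hi); positivity
      filter_upwards [hρ.eventually (Metric.ball_mem_nhds 0 hpos)] with z hz
      have : |(d i + r (π z) / ‖π z‖ ^ 2) - d i| ≤ |d i| / 2 := by
        have h := hz
        rw [dist_zero_right, Real.norm_eq_abs] at h
        simpa using h.le
      rw [← sign_eq_of_abs_sub_le this, sign_mul_abs]
    filter_upwards [hsgn] with z hz
    have hππ : π (π z) = π z := coordProj_eq_self fun i hi => by simp [π, coordProj_apply, hi]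
    have hpr : ∀ i ∈ W, pr i (π z) = z i := fun i hi => by simp [pr, π, coordProj_apply, hi]
    have hnorm : ‖π z‖ ^ 2 = ∑ i ∈ W, z i ^ 2 := by
      rw [EuclideanSpace.real_norm_sq_eq, ← Finset.sum_subset (Finset.subset_univ W)]
      · exact Finset.sum_congr rfl fun i hi => by rw [← hpr i hi]; rfl
      · intro i _ hi; simp [π, coordProj_apply, hi]
    have hterm : ∀ i ∈ W, (SignType.sign (d i) : ℝ) * κ₀ i (π z) ^ 2 =
        d i * z i ^ 2 + r (π z) / ‖π z‖ ^ 2 * z i ^ 2 := by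
      intro i hi
      simp only [κ₀, ψ, hpr i hi, mul_pow, Real.sq_sqrt (abs_nonneg _)]
      linear_combination (z i ^ 2) * hz i hi
    have hrπ : r (π z) = f (π z) - f 0 - ∑ i ∈ W, d i * z i ^ 2 := by
      simp only [r, hππ]
      rw [Finset.sum_congr rfl fun i hi => by rw [hpr i hi]]
    have hquot : r (π z) / ‖π z‖ ^ 2 * ‖π z‖ ^ 2 = r (π z) := by
      by_cases h : π z = 0
      · simp [h, hr0]
      · exact div_mul_cancel₀ _ (by simpa using h)
    rw [Finset.sum_congr rfl hterm, Finset.sum_add_distrib, ← Finset.mul_sum, ← hnorm, hquot,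
      hrπ]
    ring

/-- A function of class `C²` on `ℝⁿ` whose partial derivatives at the origin do not vanish for the
coordinates in `A` and which has, in the coordinates in `W`, a nondegenerate critical point with
diagonal Hessian, becomes a sum of a linear and a quadratic form on the subspace where all
remaining coordinates vanish. The change of coordinates has an invertible derivative, fixes the
remaining coordinates and preserves the sign of each coordinate in `A`. -/
theorem exists_linear_quadratic_coordinates {n : ℕ} (A W : Finset (Fin n)) (hAW : Disjoint A W)
    {f : EuclideanSpace ℝ (Fin n) → ℝ} (hf : ContDiffAt ℝ 2 f 0)
    (hA : ∀ i ∈ A, fderiv ℝ f 0 (EuclideanSpace.single i 1) ≠ 0)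
    (hW : ∀ i ∈ W, fderiv ℝ f 0 (EuclideanSpace.single i 1) = 0) (d : Fin n → ℝ)
    (hd : ∀ i ∈ W, d i ≠ 0)
    (hess : ∀ i ∈ W, ∀ j ∈ W, fderiv ℝ (fderiv ℝ f) 0 (EuclideanSpace.single i 1)
      (EuclideanSpace.single j 1) = if i = j then 2 * d i else 0) :
    ∃ (Θ : EuclideanSpace ℝ (Fin n) → EuclideanSpace ℝ (Fin n))
      (Θ' : EuclideanSpace ℝ (Fin n) →L[ℝ] EuclideanSpace ℝ (Fin n)),
      Θ 0 = 0 ∧ ContDiffAt ℝ 1 Θ 0 ∧ HasFDerivAt Θ Θ' 0 ∧ Function.Injective Θ' ∧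
      (∀ z, ∀ i ∉ A, i ∉ W → Θ z i = z i) ∧
      (∀ᶠ z in 𝓝 0, ∀ i ∈ A, SignType.sign (Θ z i) = SignType.sign (z i)) ∧
      ∀ᶠ z in 𝓝 0, (∀ i ∉ A, i ∉ W → z i = 0) →
        f z = f 0 + ∑ i ∈ A,
            (SignType.sign (fderiv ℝ f 0 (EuclideanSpace.single i 1)) : ℝ) * Θ z i
          + ∑ i ∈ W, (SignType.sign (d i) : ℝ) * Θ z i ^ 2 := by
  obtain ⟨Δ, hΔ, hΔsum⟩ := exists_increment_coordinates A W hAW (hf.of_le (by norm_num)) hA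
  obtain ⟨κ, hκ, hκsum⟩ := exists_morse_coordinates W hf hW d hd hess
  let σ : Fin n → ℝ := fun i => SignType.sign (fderiv ℝ f 0 (EuclideanSpace.single i 1))
  -- the increments are normalized so as to have the sign of their coordinate
  have hσσ : ∀ i ∈ A, σ i * σ i = 1 := by
    intro i hi
    rcases (hA i hi).lt_or_gt with h | h <;> simp [σ, h]
  let θ : Fin n → EuclideanSpace ℝ (Fin n) → ℝ := fun i z =>
    if i ∈ A then σ i * Δ i z else if i ∈ W then κ i z else z i
  have hθ : ∀ i, θ i 0 = 0 ∧ ContDiffAt ℝ 1 (θ i) 0 ∧ ∃ c : ℝ, c ≠ 0 ∧ HasFDerivAt (θ i)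
      (c • (EuclideanSpace.proj i : EuclideanSpace ℝ (Fin n) →L[ℝ] ℝ)) 0 := by
    intro i
    by_cases hi : i ∈ A
    · have e : θ i = fun z => σ i * Δ i z := by funext z; simp [θ, hi]
      obtain ⟨h0, h1, h2, -⟩ := hΔ i hi
      rw [e]
      refine ⟨by simp [h0], contDiffAt_const.mul h1, _, ?_,
        (h2.const_mul (σ i)).congr_fderiv (smul_smul _ _ _)⟩
      exact mul_ne_zero (left_ne_zero_of_mul_eq_one (hσσ i hi)) (hA i hi)
    by_cases hi' : i ∈ W
    · have e : θ i = κ i := by funext z; simp [θ, hi, hi']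
      rw [e]
      exact hκ i hi'
    · have e : θ i = fun z => (EuclideanSpace.proj i : EuclideanSpace ℝ (Fin n) →L[ℝ] ℝ) z := by
        funext z; simp [θ, hi, hi']
      rw [e]
      refine ⟨map_zero _, ContinuousLinearMap.contDiff _ |>.contDiffAt, 1, one_ne_zero, ?_⟩
      rw [one_smul]
      exact ContinuousLinearMap.hasFDerivAt _
  choose hθ0 hθcd c hc hθd using hθ
  let Θ : EuclideanSpace ℝ (Fin n) → EuclideanSpace ℝ (Fin n) := fun z =>
    WithLp.toLp 2 fun i => θ i z
  have hcd : ContDiffAt ℝ 1 Θ 0 := contDiffAt_euclidean.2 hθcd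
  have hder := (hcd.differentiableAt (by norm_num)).hasFDerivAt
  have hcomp : ∀ i v, fderiv ℝ Θ 0 v i = c i * v i := by
    intro i v
    have h1 := (EuclideanSpace.proj i : EuclideanSpace ℝ (Fin n) →L[ℝ] ℝ).hasFDerivAt.comp
      (0 : EuclideanSpace ℝ (Fin n)) hder
    have h2 := h1.unique (hθd i)
    simpa using DFunLike.congr_fun h2 v
  refine ⟨Θ, fderiv ℝ Θ 0, ?_, hcd, hder, ?_, ?_, ?_, ?_⟩
  · ext i; simp [Θ, hθ0]
  · rw [injective_iff_map_eq_zero]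
    intro v hv
    ext i
    have := hcomp i v
    rw [hv] at this
    simpa [hc i] using this.symm
  · intro z i hi hi'
    simp [Θ, θ, hi, hi']
  · rw [Filter.eventually_all_finset]
    intro i hi
    filter_upwards [(hΔ i hi).2.2.2] with z hz
    have e : Θ z i = σ i * Δ i z := by simp [Θ, θ, hi]
    have hs : SignType.sign (σ i) = SignType.sign (fderiv ℝ f 0 (EuclideanSpace.single i 1)) := by
      rcases (hA i hi).lt_or_gt with h | h <;> simp [σ, h]
    rw [e, sign_mul, hz, hs, ← mul_assoc]
    rcases (hA i hi).lt_or_gt with h | h <;> simp [h]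
  · filter_upwards [hκsum] with z hz hz0
    have e1 : ∑ i ∈ A, σ i * Θ z i = ∑ i ∈ A, Δ i z := by
      refine Finset.sum_congr rfl fun i hi => ?_
      have e : Θ z i = σ i * Δ i z := by simp [Θ, θ, hi]
      rw [e, ← mul_assoc, hσσ i hi, one_mul]
    have e2 : ∑ i ∈ W, (SignType.sign (d i) : ℝ) * Θ z i ^ 2 =
        ∑ i ∈ W, (SignType.sign (d i) : ℝ) * κ i z ^ 2 := by
      refine Finset.sum_congr rfl fun i hi => ?_
      have e : Θ z i = κ i z := by
        simp [Θ, θ, hi, Finset.disjoint_right.1 hAW hi]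
      rw [e]
    have e3 : coordProj (A ∪ W) z = z := coordProj_eq_self fun i hi => by
      rw [Finset.mem_union, not_or] at hi
      exact hz0 i hi.1 hi.2
    rw [e2, add_right_comm, ← hz]
    change f z = f (coordProj W z) + ∑ i ∈ A, σ i * Θ z i
    rw [e1, hΔsum, e3]
    ring

/-! ### The chart adapted to the constraints -/

theorem finrank_add_card_of_linearIndependent {V α : Type*} [AddCommGroup V] [Module ℝ V]
    [FiniteDimensional ℝ V] [Fintype α] {l : α → Module.Dual ℝ V} (hl : LinearIndependent ℝ l)
    {T : Submodule ℝ V} (hT : ∀ v, v ∈ T ↔ ∀ a, l a v = 0) :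
    Fintype.card α + Module.finrank ℝ T = Module.finrank ℝ V := by
  have h := Subspace.finrank_add_finrank_dualCoannihilator_eq (Submodule.span ℝ (Set.range l))
  rw [finrank_span_eq_card hl] at h
  have : T = (Submodule.span ℝ (Set.range l)).dualCoannihilator := by
    ext v
    rw [hT, Submodule.mem_dualCoannihilator]
    refine ⟨fun hv φ hφ => ?_, fun hv a => hv _ (Submodule.subset_span ⟨a, rfl⟩)⟩
    induction hφ using Submodule.span_induction with
    | mem φ h => obtain ⟨a, rfl⟩ := h; exact hv a
    | zero => simp
    | add φ χ _ _ h₁ h₂ => simp [h₁, h₂]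
    | smul c φ _ h => simp [h]
  rw [this]
  exact h

/-- An orthonormal basis of a subspace that diagonalizes a bilinear form whose matrix in the
orthonormal basis `b` is symmetric. -/
theorem exists_orthonormalBasis_diagonalizing {E : Type*} [NormedAddCommGroup E]
    [InnerProductSpace ℝ E] {T : Submodule ℝ E} {m : ℕ} (b : OrthonormalBasis (Fin m) ℝ T)
    (B : E →L[ℝ] E →L[ℝ] ℝ)
    (hM : (Matrix.of fun i j => B (b i : E) (b j : E) : Matrix (Fin m) (Fin m) ℝ).IsHermitian) :
    ∃ ξ : OrthonormalBasis (Fin m) ℝ T,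
      ∀ i j, B (ξ i : E) (ξ j : E) = if i = j then hM.eigenvalues i else 0 := by
  let u := hM.eigenvectorBasis
  refine ⟨u.map b.repr.symm, fun i j => ?_⟩
  have hξ : ∀ i, ((u.map b.repr.symm i : T) : E) = ∑ k, u i k • (b k : E) := by
    intro i
    rw [OrthonormalBasis.map_apply, ← b.sum_repr_symm]
    simp
  have h1 : B ((u.map b.repr.symm i : T) : E) ((u.map b.repr.symm j : T) : E) =
      (u i).ofLp ⬝ᵥ ((Matrix.of fun i j => B (b i : E) (b j : E) :
        Matrix (Fin m) (Fin m) ℝ).mulVec (u j).ofLp) := by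
    rw [hξ, hξ]
    simp only [map_sum, map_smul, sum_apply, smul_apply, smul_eq_mul, dotProduct, Matrix.mulVec,
      Matrix.of_apply, Finset.mul_sum]
    refine (Finset.sum_comm).trans ?_
    refine Finset.sum_congr rfl fun k _ => Finset.sum_congr rfl fun l _ => ?_
    ring
  have h2 := u.inner_eq_ite i j
  rw [EuclideanSpace.inner_eq_star_dotProduct] at h2
  simp only [star_trivial] at h2
  rw [h1, hM.mulVec_eigenvectorBasis, dotProduct_smul, dotProduct_comm, h2]
  split_ifs with h
  · subst h; simp
  · simp

/-- The second derivative of `g ∘ φ` at a point that `φ` maps to a critical point of `g`: the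
second derivative of `φ` does not contribute. -/
theorem fderiv_fderiv_comp_of_fderiv_eq_zero {E F : Type*} [NormedAddCommGroup E]
    [NormedSpace ℝ E] [NormedAddCommGroup F] [NormedSpace ℝ F] {g : F → ℝ} {φ : E → F} {y : E}
    (hg : ContDiffAt ℝ 2 g (φ y)) (hφ : ContDiffAt ℝ 2 φ y) (hcrit : fderiv ℝ g (φ y) = 0)
    (u v : E) :
    fderiv ℝ (fderiv ℝ fun z => g (φ z)) y u v =
      fderiv ℝ (fderiv ℝ g) (φ y) (fderiv ℝ φ y u) (fderiv ℝ φ y v) := by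
  have h1 : ∀ᶠ z in 𝓝 y, fderiv ℝ (fun z => g (φ z)) z =
      (fderiv ℝ g (φ z)).comp (fderiv ℝ φ z) := by
    filter_upwards [hφ.continuousAt.eventually (hg.eventually (by decide)),
      hφ.eventually (by decide)] with z hz hz'
    exact ((hz.differentiableAt (by norm_num)).hasFDerivAt.comp z
      (hz'.differentiableAt (by norm_num)).hasFDerivAt).fderiv
  have hg' : HasFDerivAt (fderiv ℝ g) (fderiv ℝ (fderiv ℝ g) (φ y)) (φ y) :=
    ((hg.fderiv_right (m := 1) (by norm_num [one_add_one_eq_two])).differentiableAt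
      (by norm_num)).hasFDerivAt
  have hφ' : HasFDerivAt (fderiv ℝ φ) (fderiv ℝ (fderiv ℝ φ) y) y :=
    ((hφ.fderiv_right (m := 1) (by norm_num [one_add_one_eq_two])).differentiableAt
      (by norm_num)).hasFDerivAt
  have h2 := (hg'.comp y (hφ.differentiableAt (by norm_num)).hasFDerivAt).clm_comp hφ'
  rw [(h2.congr_of_eventuallyEq h1).fderiv]
  simp [hcrit]

/-- A chart of class `C²` around a point `x` whose first coordinates are constraint functions
`G a` vanishing at `x` and whose last coordinates are linear. In this chart the multipliers of `f`
become its partial derivatives, and the Hessian of the Lagrange function on the tangent space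
becomes the Hessian of `f` in the last coordinates. -/
theorem exists_adapted_chart {n : ℕ} {α ω : Type*} [Fintype α] [Fintype ω] [DecidableEq ω]
    (e : α ⊕ ω ≃ Fin n)
    {f : EuclideanSpace ℝ (Fin n) → ℝ} {G : α → EuclideanSpace ℝ (Fin n) → ℝ}
    {x : EuclideanSpace ℝ (Fin n)} (hf : ContDiff ℝ 2 f) (hG : ∀ a, ContDiff ℝ 2 (G a))
    (hGx : ∀ a, G a x = 0) {T : Submodule ℝ (EuclideanSpace ℝ (Fin n))}
    (hT : ∀ v, v ∈ T ↔ ∀ a, fderiv ℝ (G a) x v = 0) (ξ : OrthonormalBasis ω ℝ T)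
    (c : α → ℝ) (hstat : fderiv ℝ f x = ∑ a, c a • fderiv ℝ (G a) x) (d : ω → ℝ)
    (hess : ∀ r t, fderiv ℝ (fderiv ℝ fun z => f z - ∑ a, c a * G a z) x
      (ξ r : EuclideanSpace ℝ (Fin n)) (ξ t : EuclideanSpace ℝ (Fin n)) =
        if r = t then d r else 0) :
    ∃ (Φ φ : EuclideanSpace ℝ (Fin n) → EuclideanSpace ℝ (Fin n))
      (Φ' : EuclideanSpace ℝ (Fin n) →L[ℝ] EuclideanSpace ℝ (Fin n)),
      Φ x = 0 ∧ φ 0 = x ∧ ContDiffAt ℝ 2 Φ x ∧ HasFDerivAt Φ Φ' x ∧ Function.Injective Φ' ∧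
      (∀ z a, Φ z (e (.inl a)) = G a z) ∧ (∀ᶠ z in 𝓝 x, φ (Φ z) = z) ∧
      ContDiffAt ℝ 2 (fun y => f (φ y)) 0 ∧
      (∀ a, fderiv ℝ (fun y => f (φ y)) 0 (EuclideanSpace.single (e (.inl a)) 1) = c a) ∧
      (∀ r, fderiv ℝ (fun y => f (φ y)) 0 (EuclideanSpace.single (e (.inr r)) 1) = 0) ∧
      ∀ r t, fderiv ℝ (fderiv ℝ fun y => f (φ y)) 0 (EuclideanSpace.single (e (.inr r)) 1)
        (EuclideanSpace.single (e (.inr t)) 1) = if r = t then d r else 0 := by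
  let ℓ : α ⊕ ω → EuclideanSpace ℝ (Fin n) → ℝ :=
    Sum.elim G fun r z => innerSL ℝ (ξ r : EuclideanSpace ℝ (Fin n)) (z - x)
  have hℓ : ∀ i, ContDiff ℝ 2 (ℓ i) := by
    rintro (a | r)
    · exact hG a
    · exact (innerSL ℝ (ξ r : EuclideanSpace ℝ (Fin n))).contDiff.comp
        (contDiff_id.sub contDiff_const)
  let Φ : EuclideanSpace ℝ (Fin n) → EuclideanSpace ℝ (Fin n) := fun z =>
    WithLp.toLp 2 fun i => ℓ (e.symm i) z
  have hΦe : ∀ z i, Φ z (e i) = ℓ i z := fun z i => by simp [Φ]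
  have hΦ : ContDiffAt ℝ 2 Φ x := contDiffAt_euclidean.2 fun i => (hℓ _).contDiffAt
  have hder : HasFDerivAt Φ (fderiv ℝ Φ x) x := (hΦ.differentiableAt (by norm_num)).hasFDerivAt
  have hcomp : ∀ i v, fderiv ℝ Φ x v (e i) = fderiv ℝ (ℓ i) x v := by
    intro i v
    have h1 := (EuclideanSpace.proj (e i) : EuclideanSpace ℝ (Fin n) →L[ℝ] ℝ).hasFDerivAt.comp
      x hder
    have h2 : HasFDerivAt ((EuclideanSpace.proj (e i) : EuclideanSpace ℝ (Fin n) →L[ℝ] ℝ) ∘ Φ)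
        (fderiv ℝ (ℓ i) x) x :=
      ((hℓ i).contDiffAt.differentiableAt (by norm_num)).hasFDerivAt.congr_of_eventuallyEq
        (Eventually.of_forall fun z => hΦe z i)
    simpa using DFunLike.congr_fun (h1.unique h2) v
  have hcompl : ∀ a v, fderiv ℝ Φ x v (e (.inl a)) = fderiv ℝ (G a) x v := fun a v =>
    hcomp (.inl a) v
  have hcompr : ∀ r v, fderiv ℝ Φ x v (e (.inr r)) =
      inner ℝ (ξ r : EuclideanSpace ℝ (Fin n)) v := by
    intro r v
    rw [hcomp]
    have h2 := (innerSL ℝ (ξ r : EuclideanSpace ℝ (Fin n))).hasFDerivAt.comp x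
      ((hasFDerivAt_id x).sub_const x)
    have h3 : fderiv ℝ (ℓ (.inr r)) x = innerSL ℝ (ξ r : EuclideanSpace ℝ (Fin n)) := h2.fderiv
    rw [h3]
    simp
  have hinj : Function.Injective (fderiv ℝ Φ x) := by
    rw [injective_iff_map_eq_zero]
    intro v hv
    have hvT : v ∈ T := (hT v).2 fun a => by rw [← hcompl, hv]; rfl
    have : (⟨v, hvT⟩ : T) = 0 := by
      rw [← ξ.sum_repr' ⟨v, hvT⟩]
      refine Finset.sum_eq_zero fun r _ => ?_
      rw [Submodule.coe_inner, ← hcompr, hv]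
      exact zero_smul ℝ _
    simpa using this
  have hΦx : Φ x = 0 := by
    ext i
    obtain ⟨j, rfl⟩ := e.surjective i
    rw [hΦe]
    rcases j with a | r
    · exact hGx a
    · simp [ℓ]
  obtain ⟨Ψ, hΨ, hxΨ, -, -, hΨs⟩ := exists_openPartialHomeomorph_of_injective (m := 2)
    (by norm_num) (by decide) hΦ hder hinj univ_mem
  have h0t : (0 : EuclideanSpace ℝ (Fin n)) ∈ Ψ.target := by
    rw [← hΦx, ← hΨ]; exact Ψ.map_source hxΨ
  have hφ0 : Ψ.symm 0 = x := by
    rw [← hΦx, ← hΨ]; exact Ψ.left_inv hxΨ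
  have hleft : ∀ᶠ z in 𝓝 x, Ψ.symm (Φ z) = z := by
    filter_upwards [Ψ.open_source.mem_nhds hxΨ] with z hz
    rw [← hΨ, Ψ.left_inv hz]
  have hright : ∀ᶠ y in 𝓝 (0 : EuclideanSpace ℝ (Fin n)), Φ (Ψ.symm y) = y := by
    filter_upwards [Ψ.open_target.mem_nhds h0t] with y hy
    rw [← hΨ, Ψ.right_inv hy]
  have hφ : ContDiffAt ℝ 2 Ψ.symm 0 := hΨs.contDiffAt (Ψ.open_target.mem_nhds h0t)
  have hφd : HasFDerivAt Ψ.symm (fderiv ℝ Ψ.symm 0) 0 :=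
    (hφ.differentiableAt (by norm_num)).hasFDerivAt
  have hinv : ∀ v, fderiv ℝ Φ x (fderiv ℝ Ψ.symm 0 v) = v := by
    intro v
    have hder' : HasFDerivAt Φ (fderiv ℝ Φ x) (Ψ.symm 0) := by rwa [hφ0]
    have h1 := (hder'.comp (0 : EuclideanSpace ℝ (Fin n)) hφd).congr_of_eventuallyEq
      (f₁ := fun y => y) (hright.mono fun y hy => hy.symm)
    exact DFunLike.congr_fun (h1.unique (hasFDerivAt_id _)) v
  -- the inverse chart maps the last coordinate directions to the given basis of the tangent space
  have hφξ : ∀ r, fderiv ℝ Ψ.symm 0 (EuclideanSpace.single (e (.inr r)) 1) = ξ r := by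
    intro r
    apply hinj
    rw [hinv]
    ext i
    obtain ⟨j, rfl⟩ := e.surjective i
    rcases j with a | t
    · rw [hcompl, (hT _).1 (ξ r).2 a]
      simp
    · rw [hcompr, ← Submodule.coe_inner, ξ.inner_eq_ite]
      simp [PiLp.single_apply]
  have hfφ : ContDiffAt ℝ 2 (fun y => f (Ψ.symm y)) 0 :=
    hf.contDiffAt.comp (0 : EuclideanSpace ℝ (Fin n)) hφ
  have hfd : ∀ v, fderiv ℝ (fun y => f (Ψ.symm y)) 0 v =
      ∑ a, c a * v (e (.inl a)) := by
    intro v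
    have h1 : HasFDerivAt f (fderiv ℝ f x) (Ψ.symm 0) := by
      rw [hφ0]; exact (hf.differentiable (by norm_num) x).hasFDerivAt
    have h2 : fderiv ℝ (fun y => f (Ψ.symm y)) 0 = _ :=
      (h1.comp (0 : EuclideanSpace ℝ (Fin n)) hφd).fderiv
    rw [h2, hstat]
    simp only [ContinuousLinearMap.comp_apply, sum_apply, smul_apply, smul_eq_mul, ← hcompl, hinv]
  refine ⟨Φ, Ψ.symm, fderiv ℝ Φ x, hΦx, hφ0, hΦ, hder, hinj, fun z a => hΦe z (.inl a), hleft,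
    hfφ, fun a => ?_, fun r => ?_, fun r t => ?_⟩
  · classical
    rw [hfd]
    simp [PiLp.single_apply]
  · rw [hfd]
    simp
  · let L : EuclideanSpace ℝ (Fin n) → ℝ := fun z => f z - ∑ a, c a * G a z
    have hL : ContDiff ℝ 2 L :=
      hf.sub (ContDiff.sum fun a _ => contDiff_const.mul (hG a))
    have hLx : fderiv ℝ L x = 0 := by
      have h1 : HasFDerivAt L (fderiv ℝ f x - ∑ a, c a • fderiv ℝ (G a) x) x :=
        (hf.differentiable (by norm_num) x).hasFDerivAt.sub <| HasFDerivAt.fun_sum fun a _ =>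
          ((hG a).differentiable (by norm_num) x).hasFDerivAt.const_mul (c a)
      rw [h1.fderiv, hstat, sub_self]
    -- near the origin `f ∘ φ` and `L ∘ φ` differ by a linear form
    let m : EuclideanSpace ℝ (Fin n) →L[ℝ] ℝ :=
      ∑ a, c a • (EuclideanSpace.proj (e (.inl a)) : EuclideanSpace ℝ (Fin n) →L[ℝ] ℝ)
    have hLφ : ContDiffAt ℝ 2 (fun y => L (Ψ.symm y)) 0 :=
      hL.contDiffAt.comp (0 : EuclideanSpace ℝ (Fin n)) hφ
    have heq : (fun y => f (Ψ.symm y)) =ᶠ[𝓝 0] fun y => L (Ψ.symm y) + m y := by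
      filter_upwards [hright] with y hy
      have : ∀ a, G a (Ψ.symm y) = y (e (.inl a)) := fun a => by
        have := hΦe (Ψ.symm y) (.inl a)
        rw [hy] at this
        exact this.symm
      simp [L, m, this]
    have heq' : fderiv ℝ (fun y => f (Ψ.symm y)) =ᶠ[𝓝 0]
        fun y => fderiv ℝ (fun y => L (Ψ.symm y)) y + m := by
      filter_upwards [heq.eventuallyEq_nhds, hLφ.eventually (by decide)] with y hy hy'
      rw [hy.fderiv_eq]
      exact ((hy'.differentiableAt (by norm_num)).hasFDerivAt.add m.hasFDerivAt).fderiv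
    rw [heq'.fderiv_eq, fderiv_add_const, fderiv_fderiv_comp_of_fderiv_eq_zero hL.contDiffAt hφ
      (by rw [hφ0]; exact hLx), hφ0, hφξ, hφξ]
    exact hess r t

/-! ### Enumerating the coordinates -/

/-- An enumeration of `ζ ⊕ (β ⊕ γ × Fin 2) ⊕ Fin p` by `Fin n` in this order, the two elements
belonging to one element of `γ` getting consecutive numbers. -/
theorem exists_blockwise_enumeration {ζ β γ : Type*} [Fintype ζ] [Fintype β] [Fintype γ]
    {s b c p n : ℕ} (hs : Fintype.card ζ = s) (hb : Fintype.card β = b)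
    (hc : Fintype.card γ = c) (hn : s + b + 2 * c + p = n) :
    ∃ (e : (ζ ⊕ (β ⊕ γ × Fin 2)) ⊕ Fin p ≃ Fin n) (eβ : β ≃ Fin b) (eγ : γ ≃ Fin c),
      (∀ i, (e (.inl (.inl i)) : ℕ) < s) ∧ (∀ j, (e (.inl (.inr (.inl j))) : ℕ) = s + eβ j) ∧
      (∀ m k, (e (.inl (.inr (.inr (m, k)))) : ℕ) = s + b + 2 * eγ m + k) ∧
      ∀ r, (e (.inr r) : ℕ) = n - p + r := by
  let eζ := Fintype.equivFinOfCardEq hs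
  let eβ := Fintype.equivFinOfCardEq hb
  let eγ := Fintype.equivFinOfCardEq hc
  have hn' : s + (b + c * 2) + p = n := by omega
  let e : (ζ ⊕ (β ⊕ γ × Fin 2)) ⊕ Fin p ≃ Fin n :=
    ((((eζ.sumCongr ((eβ.sumCongr ((eγ.prodCongr (Equiv.refl _)).trans finProdFinEquiv)).trans
      finSumFinEquiv)).trans finSumFinEquiv).sumCongr (Equiv.refl _)).trans finSumFinEquiv).trans
      (finCongr hn')
  refine ⟨e, eβ, eγ, fun i => ?_, fun j => ?_, fun m k => ?_, fun r => ?_⟩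
  · simp [e]
  · simp [e]
  · simp [e]; ring
  · simp [e]; omega

/-! ### Active constraints -/

namespace MPOC

variable {n k : ℕ} {I J : Type*}

section

variable (P : MPOC n I J k) {x : EuclideanSpace ℝ (Fin n)}

theorem mem_a₀₀ {m : Fin k} : m ∈ P.a₀₀ x ↔ P.F₁ m x = 0 ∧ P.F₂ m x = 0 := by simp [a₀₀]

theorem mem_a₀₁ {m : Fin k} : m ∈ P.a₀₁ x ↔ P.F₁ m x = 0 ∧ 0 < P.F₂ m x := by simp [a₀₁]

theorem mem_a₁₀ {m : Fin k} : m ∈ P.a₁₀ x ↔ P.F₁ m x ≠ 0 ∧ P.F₂ m x = 0 := by simp [a₁₀]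

end

/-- The indices of the active constraint functions at `x`: first the functions vanishing on the
feasible set near `x`, then the active inequality constraints and, for each biactive
orthogonality type constraint, its two functions. -/
abbrev ActiveIndex [Fintype J] (P : MPOC n I J k) (x : EuclideanSpace ℝ (Fin n)) : Type _ :=
  (I ⊕ (P.a₀₁ x ⊕ P.a₁₀ x)) ⊕ (P.J₀ x ⊕ P.a₀₀ x × Fin 2)

/-- The active constraint functions at `x`. -/
def activeConstraint [Fintype J] (P : MPOC n I J k) (x : EuclideanSpace ℝ (Fin n)) :
    P.ActiveIndex x → EuclideanSpace ℝ (Fin n) → ℝ :=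
  Sum.elim (Sum.elim P.h (Sum.elim (fun m => P.F₁ m) (fun m => P.F₂ m)))
    (Sum.elim (fun j => P.g j) (fun mb => ![P.F₁ mb.1, P.F₂ mb.1] mb.2))

/-- The multipliers `Λ` as one family indexed by the active constraint functions. -/
def Multipliers.toFun [Fintype J] {P : MPOC n I J k} {x : EuclideanSpace ℝ (Fin n)}
    (Λ : P.Multipliers x) : P.ActiveIndex x → ℝ :=
  Sum.elim (Sum.elim Λ.lam (Sum.elim Λ.sigma₁ Λ.sigma₂))
    (Sum.elim Λ.mu (fun mb => ![Λ.rho₁ mb.1, Λ.rho₂ mb.1] mb.2))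

section

variable [Fintype J] (P : MPOC n I J k) {x : EuclideanSpace ℝ (Fin n)}

theorem contDiff_activeConstraint (a : P.ActiveIndex x) :
    ContDiff ℝ 2 (P.activeConstraint x a) := by
  rcases a with (i | m | m) | j | ⟨m, b⟩
  · exact P.contDiff_h i
  · exact P.contDiff_F₁ m
  · exact P.contDiff_F₂ m
  · exact P.contDiff_g j
  · fin_cases b
    · exact P.contDiff_F₁ m
    · exact P.contDiff_F₂ m

theorem mem_J₀ {j : J} : j ∈ P.J₀ x ↔ P.g j x = 0 := by simp [J₀]

theorem activeConstraint_self (hx : x ∈ P.feasibleSet) (a : P.ActiveIndex x) :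
    P.activeConstraint x a x = 0 := by
  rcases a with (i | m | m) | j | ⟨m, b⟩
  · exact hx.1 i
  · exact (P.mem_a₀₁.1 m.2).1
  · exact (P.mem_a₁₀.1 m.2).2
  · exact P.mem_J₀.1 j.2
  · fin_cases b
    · exact (P.mem_a₀₀.1 m.2).1
    · exact (P.mem_a₀₀.1 m.2).2

/-- The family in `LICQ` is indexed by unions of index sets, `activeConstraint` by disjoint sums;
the two are related by an injection because `a₀₁` and `a₁₀` are disjoint from `a₀₀`. -/
theorem linearIndependent_activeConstraint (h : P.LICQ x) :
    LinearIndependent ℝ fun a => fderiv ℝ (P.activeConstraint x a) x := by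
  classical
  let τ : P.ActiveIndex x → I ⊕ (P.J₀ x ⊕ ((P.a₀₁ x ∪ P.a₀₀ x : Finset (Fin k)) ⊕
      (P.a₁₀ x ∪ P.a₀₀ x : Finset (Fin k)))) :=
    Sum.elim (Sum.elim Sum.inl (Sum.elim
        (fun m => .inr (.inr (.inl ⟨m, by simp⟩)))
        (fun m => .inr (.inr (.inr ⟨m, by simp⟩)))))
      (Sum.elim (fun j => .inr (.inl j)) (fun mb =>
        ![.inr (.inr (.inl ⟨mb.1, by simp⟩)), .inr (.inr (.inr ⟨mb.1, by simp⟩))] mb.2))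
  have hτ : Function.Injective τ := by
    have h01 : ∀ m ∈ P.a₀₁ x, m ∉ P.a₀₀ x := fun m hm hm' =>
      (P.mem_a₀₁.1 hm).2.ne' (P.mem_a₀₀.1 hm').2
    have h10 : ∀ m ∈ P.a₁₀ x, m ∉ P.a₀₀ x := fun m hm hm' =>
      (P.mem_a₁₀.1 hm).1 (P.mem_a₀₀.1 hm').1
    rintro ((i | m | m) | j | ⟨m, b⟩) ((i' | m' | m') | j' | ⟨m', b'⟩) hab <;>
      (try fin_cases b) <;> (try fin_cases b') <;>
      simp [τ] at hab ⊢ <;> try exact hab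
    · exact h01 m m.2 (hab ▸ m'.2)
    · exact h10 m m.2 (hab ▸ m'.2)
    · exact h01 m' m'.2 (hab ▸ m.2)
    · exact h10 m' m'.2 (hab ▸ m.2)
  have := h.comp τ hτ
  convert this using 1
  funext a
  rcases a with (i | m | m) | j | ⟨m, b⟩
  · rfl
  · rfl
  · rfl
  · rfl
  · fin_cases b <;> rfl

theorem mem_tangentSpace_iff (v : EuclideanSpace ℝ (Fin n)) :
    v ∈ P.tangentSpace x ↔ ∀ a, fderiv ℝ (P.activeConstraint x a) x v = 0 := by
  constructor
  · rintro ⟨h1, h2, h3, h4, h5⟩ ((i | m | m) | j | ⟨m, b⟩)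
    · exact h1 i
    · exact h3 m m.2
    · exact h4 m m.2
    · exact h2 j j.2
    · fin_cases b
      · exact (h5 m m.2).1
      · exact (h5 m m.2).2
  · intro h
    exact ⟨fun i => h (.inl (.inl i)), fun j hj => h (.inr (.inl ⟨j, hj⟩)),
      fun m hm => h (.inl (.inr (.inl ⟨m, hm⟩))), fun m hm => h (.inl (.inr (.inr ⟨m, hm⟩))),
      fun m hm => ⟨h (.inr (.inr (⟨m, hm⟩, 0))), h (.inr (.inr (⟨m, hm⟩, 1)))⟩⟩

/-- Near a feasible point the feasible set is described by the active constraint functions. -/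
theorem eventually_mem_feasibleSet_iff (hx : x ∈ P.feasibleSet) :
    ∀ᶠ z in 𝓝 x, z ∈ P.feasibleSet ↔
      (∀ i, P.activeConstraint x (.inl i) z = 0) ∧
      (∀ j, 0 ≤ P.activeConstraint x (.inr (.inl j)) z) ∧
      ∀ m, (P.activeConstraint x (.inr (.inr (m, 0))) z,
        P.activeConstraint x (.inr (.inr (m, 1))) z) ∈ orthogonalitySet := by
  have hg : ∀ᶠ z in 𝓝 x, ∀ j, 0 < P.g j x → 0 < P.g j z :=
    eventually_all.2 fun j => Filter.eventually_imp_distrib_left.2 fun h =>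
      (P.contDiff_g j).continuous.continuousAt.eventually (lt_mem_nhds h)
  have hF₁ : ∀ᶠ z in 𝓝 x, ∀ m, P.F₁ m x ≠ 0 → P.F₁ m z ≠ 0 :=
    eventually_all.2 fun m => Filter.eventually_imp_distrib_left.2 fun h =>
      (P.contDiff_F₁ m).continuous.continuousAt.eventually_ne h
  have hF₂ : ∀ᶠ z in 𝓝 x, ∀ m, 0 < P.F₂ m x → 0 < P.F₂ m z :=
    eventually_all.2 fun m => Filter.eventually_imp_distrib_left.2 fun h =>
      (P.contDiff_F₂ m).continuous.continuousAt.eventually (lt_mem_nhds h)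
  filter_upwards [hg, hF₁, hF₂] with z hgz hF₁z hF₂z
  constructor
  · rintro ⟨h1, h2, h3⟩
    refine ⟨?_, fun j => h2 j, fun m => h3 m⟩
    rintro (i | m | m)
    · exact h1 i
    · exact (mul_eq_zero.1 (h3 m).1).resolve_right (hF₂z m (P.mem_a₀₁.1 m.2).2).ne'
    · exact (mul_eq_zero.1 (h3 m).1).resolve_left (hF₁z m (P.mem_a₁₀.1 m.2).1)
  · rintro ⟨h1, h2, h3⟩
    refine ⟨fun i => h1 (.inl i), fun j => ?_, fun m => ?_⟩
    · rcases (hx.2.1 j).eq_or_lt with h | h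
      · exact h2 ⟨j, P.mem_J₀.2 h.symm⟩
      · exact (hgz j h).le
    · by_cases hm : P.F₁ m x = 0
      · rcases (hx.2.2 m).2.eq_or_lt with h | h
        · exact h3 ⟨m, P.mem_a₀₀.2 ⟨hm, h.symm⟩⟩
        · have h0 : P.F₁ m z = 0 := h1 (.inr (.inl ⟨m, P.mem_a₀₁.2 ⟨hm, h⟩⟩))
          exact ⟨by rw [h0, zero_mul], (hF₂z m h).le⟩
      · have h : P.F₂ m x = 0 := (mul_eq_zero.1 (hx.2.2 m).1).resolve_left hm
        have h0 : P.F₂ m z = 0 := h1 (.inr (.inr ⟨m, P.mem_a₁₀.2 ⟨hm, h⟩⟩))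
        exact ⟨by rw [h0, mul_zero], h0.ge⟩

end

section

variable [Fintype I] [Fintype J] (P : MPOC n I J k) {x : EuclideanSpace ℝ (Fin n)}

theorem sum_activeIndex {M : Type*} [AddCommMonoid M] (u : P.ActiveIndex x → M) :
    ∑ a, u a = ∑ i, u (.inl (.inl i)) + ∑ m, u (.inl (.inr (.inl m)))
      + ∑ m, u (.inl (.inr (.inr m))) + ∑ j, u (.inr (.inl j))
      + ∑ m, (u (.inr (.inr (m, 0))) + u (.inr (.inr (m, 1)))) := by
  simp only [Fintype.sum_sum_type, Fintype.sum_prod_type, Fin.sum_univ_two, add_assoc]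

theorem lagrangian_eq (Λ : P.Multipliers x) :
    P.lagrangian x Λ = fun z => P.f z - ∑ a, Λ.toFun a * P.activeConstraint x a z := by
  funext z
  rw [sum_activeIndex]
  simp only [lagrangian, Multipliers.toFun, activeConstraint, Sum.elim_inl, Sum.elim_inr,
    Matrix.cons_val_zero, Matrix.cons_val_one]
  ring

theorem IsTStationary.fderiv_eq {P : MPOC n I J k} {Λ : P.Multipliers x}
    (h : P.IsTStationary x Λ) :
    fderiv ℝ P.f x = ∑ a, Λ.toFun a • fderiv ℝ (P.activeConstraint x a) x := by
  rw [sum_activeIndex, h.stationary]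
  simp only [Multipliers.toFun, activeConstraint, Sum.elim_inl, Sum.elim_inr,
    Matrix.cons_val_zero, Matrix.cons_val_one]
  abel

theorem card_activeIndex : Fintype.card (P.ActiveIndex x) = P.q x + 2 * (P.a₀₀ x).card := by
  simp [q, s]
  ring

theorem isHermitian_restrictedHessian (Λ : P.Multipliers x) :
    (P.restrictedHessian x Λ).IsHermitian := by
  have hL : ContDiffAt ℝ 2 (P.lagrangian x Λ) x := by
    rw [lagrangian_eq]
    exact (P.contDiff_f.sub (ContDiff.sum fun a _ =>
      contDiff_const.mul (P.contDiff_activeConstraint a))).contDiffAt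
  have hsymm := hL.isSymmSndFDerivAt (by simp)
  ext i j
  simp only [restrictedHessian, Matrix.conjTranspose_apply, Matrix.of_apply, star_trivial]
  exact hsymm _ _

theorem quadraticIndex_eq_card (Λ : P.Multipliers x) :
    P.quadraticIndex x Λ = (Finset.univ.filter fun r =>
      (P.isHermitian_restrictedHessian Λ).eigenvalues r < 0).card := by
  rw [quadraticIndex, (P.isHermitian_restrictedHessian Λ).roots_charpoly_eq_eigenvalues,
    Multiset.countP_map]
  rfl

theorem coord_fin (y : EuclideanSpace ℝ (Fin n)) (i : Fin n) : coord y i = y i := by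
  simp [coord]

end

/-! ### Local model and normal form -/

/-- The local model and the normal form in terms of an enumeration of the coordinates by the
active constraint functions and the remaining directions. -/
theorem exists_coordinate_enumeration [Fintype I] [Fintype J] (P : MPOC n I J k)
    (x : EuclideanSpace ℝ (Fin n)) (hn : P.q x + 2 * (P.a₀₀ x).card + P.p x = n) :
    ∃ (e : P.ActiveIndex x ⊕ Fin (P.p x) ≃ Fin n) (e₀ : P.a₀₀ x ≃ Fin (P.a₀₀ x).card),
      (∀ y, y ∈ P.localModel x ↔ (∀ i, y (e (.inl (.inl i))) = 0) ∧
        (∀ j, 0 ≤ y (e (.inl (.inr (.inl j))))) ∧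
        ∀ m, (y (e (.inl (.inr (.inr (m, 0))))), y (e (.inl (.inr (.inr (m, 1)))))) ∈
          orthogonalitySet) ∧
      ∀ c ε δ y, P.normalForm x c ε δ y = c + ∑ j, y (e (.inl (.inr (.inl j))))
        + ∑ m, (((ε (e₀ m) : ℤ) : ℝ) * y (e (.inl (.inr (.inr (m, 0)))))
            - y (e (.inl (.inr (.inr (m, 1))))))
        + ∑ r, ((δ r : ℤ) : ℝ) * y (e (.inr r)) ^ 2 := by
  obtain ⟨e, eJ, e₀, h1, h2, h3, h4⟩ := exists_blockwise_enumeration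
    (ζ := I ⊕ (P.a₀₁ x ⊕ P.a₁₀ x)) (β := P.J₀ x) (γ := P.a₀₀ x) (s := P.s x)
    (by simp [s, add_assoc]) (Fintype.card_coe _) (Fintype.card_coe _) hn
  have cJ : ∀ (y : EuclideanSpace ℝ (Fin n)) j,
      coord y (P.s x + eJ j) = y (e (.inl (.inr (.inl j)))) := fun y j => by
    rw [← coord_fin, h2]
  have c₀ : ∀ (y : EuclideanSpace ℝ (Fin n)) m,
      coord y (P.q x + 2 * e₀ m) = y (e (.inl (.inr (.inr (m, 0))))) := fun y m => by
    rw [← coord_fin, h3]; simp [q]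
  have c₁ : ∀ (y : EuclideanSpace ℝ (Fin n)) m,
      coord y (P.q x + 2 * e₀ m + 1) = y (e (.inl (.inr (.inr (m, 1))))) := fun y m => by
    rw [← coord_fin, h3]; simp [q]
  have cr : ∀ (y : EuclideanSpace ℝ (Fin n)) (r : Fin (P.p x)),
      coord y (n - P.p x + r) = y (e (.inr r)) := fun y r => by
    rw [← coord_fin, h4]
  refine ⟨e, e₀, fun y => ⟨?_, ?_⟩, fun c ε δ y => ?_⟩
  · rintro ⟨k1, k2, k3⟩
    refine ⟨fun i => ?_, fun j => ?_, fun m => ?_⟩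
    · rw [← coord_fin]; exact k1 _ (h1 i)
    · rw [← cJ]; exact k2 _ (eJ j).2
    · rw [← c₀, ← c₁]; exact k3 _ (e₀ m).2
  · rintro ⟨k1, k2, k3⟩
    refine ⟨fun i hi => ?_, fun j hj => ?_, fun m hm => ?_⟩
    · have hin : i < n := by rw [← hn, q]; omega
      obtain ⟨t, ht⟩ := e.surjective ⟨i, hin⟩
      have hti : (e t : ℕ) = i := by rw [ht]
      have hs : P.s x ≤ n - P.p x := by rw [q] at hn; omega
      rcases t with (t | j | ⟨m, b⟩) | r
      · rw [← hti, coord_fin]; exact k1 t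
      · rw [h2] at hti; omega
      · rw [h3] at hti; omega
      · rw [h4] at hti; omega
    · have := k2 (eJ.symm ⟨j, hj⟩)
      rw [← cJ] at this
      simpa using this
    · have := k3 (e₀.symm ⟨m, hm⟩)
      rw [← c₀, ← c₁] at this
      simpa using this
  · rw [normalForm, ← eJ.sum_comp, ← e₀.sum_comp]
    simp only [cJ, c₀, c₁, cr]

theorem orthogonalitySet_congr_sign {a b a' b' : ℝ} (ha : SignType.sign a = SignType.sign a')
    (hb : SignType.sign b = SignType.sign b') :
    (a, b) ∈ orthogonalitySet ↔ (a', b') ∈ orthogonalitySet := by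
  have e : ∀ a b : ℝ, (a, b) ∈ orthogonalitySet ↔
      (SignType.sign a = 0 ∨ SignType.sign b = 0) ∧ SignType.sign b ≠ -1 := fun a b => by
    simp [orthogonalitySet, sign_eq_zero_iff, sign_eq_neg_one_iff]
  rw [e, e, ha, hb]

theorem nonneg_congr_sign {a a' : ℝ} (ha : SignType.sign a = SignType.sign a') :
    0 ≤ a ↔ 0 ≤ a' := by
  rw [← sign_nonneg_iff, ha, sign_nonneg_iff]
end MPOC

/-! ### The normal form theorem -/

theorem proposition2p3 {n k : ℕ} {I J : Type*} [Fintype I] [Fintype J] (P : MPOC n I J k)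
    (x : EuclideanSpace ℝ (Fin n)) (Λ : P.Multipliers x)
    (hx : P.IsNondegenerateTStationary x Λ) :
    P.q x + 2 * (P.a₀₀ x).card + P.p x = n ∧
    ∃ Ψ : OpenPartialHomeomorph (EuclideanSpace ℝ (Fin n)) (EuclideanSpace ℝ (Fin n)),
      x ∈ Ψ.source ∧ Ψ x = 0 ∧
      ContDiffOn ℝ 1 Ψ Ψ.source ∧ ContDiffOn ℝ 1 Ψ.symm Ψ.target ∧
      Ψ '' (P.feasibleSet ∩ Ψ.source) = P.localModel x ∩ Ψ.target ∧
      ∃ (ε : Fin (P.a₀₀ x).card → ℤˣ) (δ : Fin (P.p x) → ℤˣ),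
        (∀ y ∈ P.localModel x ∩ Ψ.target, P.f (Ψ.symm y) = P.normalForm x (P.f x) ε δ y) ∧
        (Finset.univ.filter (fun r => δ r = -1)).card = P.quadraticIndex x Λ := by
  classical
  have hfin : P.q x + 2 * (P.a₀₀ x).card + Module.finrank ℝ (P.tangentSpace x) = n := by
    have hl := (P.linearIndependent_activeConstraint hx.licq).map' (ContinuousLinearMap.coeLM ℝ)
      (LinearMap.ker_eq_bot.2 ContinuousLinearMap.coe_injective)
    have := finrank_add_card_of_linearIndependent hl (T := P.tangentSpace x)
      P.mem_tangentSpace_iff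
    rwa [P.card_activeIndex, finrank_euclideanSpace_fin] at this
  have hp : Module.finrank ℝ (P.tangentSpace x) = P.p x := by rw [MPOC.p]; omega
  have hn : P.q x + 2 * (P.a₀₀ x).card + P.p x = n := by rw [← hp]; exact hfin
  refine ⟨hn, ?_⟩
  obtain ⟨e, e₀, hmodel, hnormal⟩ := P.exists_coordinate_enumeration x hn
  -- an eigenbasis of the restricted Hessian
  have hM := P.isHermitian_restrictedHessian Λ
  obtain ⟨ξ, hξ⟩ := exists_orthonormalBasis_diagonalizing
    (stdOrthonormalBasis ℝ (P.tangentSpace x)) (fderiv ℝ (fderiv ℝ (P.lagrangian x Λ)) x) hM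
  let ev : Fin (P.p x) → ℝ := fun r => hM.eigenvalues ((finCongr hp).symm r)
  have hev : ∀ r, ev r ≠ 0 := by
    intro r h0
    apply hx.hessian_det_ne
    rw [hM.det_eq_prod_eigenvalues]
    exact Finset.prod_eq_zero (Finset.mem_univ ((finCongr hp).symm r)) (by simpa [ev] using h0)
  obtain ⟨Φ, φ, Φ', hΦx, hφ0, hΦ, hΦ', hΦ'inj, hΦG, hφΦ, hfφ, hd₁, hd₂, hhess⟩ :=
    exists_adapted_chart e P.contDiff_f P.contDiff_activeConstraint
      (P.activeConstraint_self hx.feasible) P.mem_tangentSpace_iff (ξ.reindex (finCongr hp))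
      Λ.toFun hx.toIsTStationary.fderiv_eq ev (by
        intro r t
        rw [← P.lagrangian_eq, OrthonormalBasis.reindex_apply, OrthonormalBasis.reindex_apply, hξ]
        exact if_congr (Equiv.apply_eq_iff_eq _) rfl rfl)
  -- coordinates entering linearly and quadratically
  let eA : P.J₀ x ⊕ P.a₀₀ x × Fin 2 ↪ Fin n :=
    ⟨fun t => e (.inl (.inr t)), fun t t' h => by simpa using h⟩
  let eW : Fin (P.p x) ↪ Fin n := ⟨fun r => e (.inr r), fun t t' h => by simpa using h⟩
  let A : Finset (Fin n) := Finset.univ.map eA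
  let W : Finset (Fin n) := Finset.univ.map eW
  have hAW : Disjoint A W := by
    rw [Finset.disjoint_left]
    intro i hA hW
    obtain ⟨t, -, rfl⟩ := Finset.mem_map.1 hA
    obtain ⟨r, -, h⟩ := Finset.mem_map.1 hW
    exact Sum.inr_ne_inl (e.injective h)
  have hΛ : ∀ t, Λ.toFun (.inr t) ≠ 0 := by
    rintro (j | ⟨m, b⟩)
    · exact (hx.mu_pos j).ne'
    · fin_cases b
      · exact (hx.rho_ne m).1
      · exact (hx.rho_ne m).2.ne
  let d : Fin n → ℝ := fun i => Sum.elim (fun _ => 0) (fun r => ev r / 2) (e.symm i)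
  have hdr : ∀ r, d (e (.inr r)) = ev r / 2 := fun r => by simp [d]
  obtain ⟨Θ, Θ', hΘ0, hΘ, hΘ', hΘ'inj, hΘfix, hΘsign, hΘf⟩ :=
    exists_linear_quadratic_coordinates A W hAW hfφ
      (by
        intro i hi
        obtain ⟨t, -, rfl⟩ := Finset.mem_map.1 hi
        exact (hd₁ (.inr t)).trans_ne (hΛ t))
      (by
        intro i hi
        obtain ⟨r, -, rfl⟩ := Finset.mem_map.1 hi
        exact hd₂ r)
      d
      (by
        intro i hi
        obtain ⟨r, -, rfl⟩ := Finset.mem_map.1 hi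
        exact (hdr r).trans_ne (div_ne_zero (hev r) two_ne_zero))
      (by
        intro i hi j hj
        obtain ⟨r, -, rfl⟩ := Finset.mem_map.1 hi
        obtain ⟨t, -, rfl⟩ := Finset.mem_map.1 hj
        refine (hhess r t).trans ?_
        simp only [EmbeddingLike.apply_eq_iff_eq]
        refine if_congr Iff.rfl ?_ rfl
        change ev r = 2 * d (e (.inr r))
        rw [hdr]
        ring)
  have hΘfix' : ∀ z i, Θ z (e (.inl (.inl i))) = z (e (.inl (.inl i))) := fun z i => by
    refine hΘfix z _ (fun h => ?_) fun h => ?_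
    · obtain ⟨t, -, ht⟩ := Finset.mem_map.1 h
      exact Sum.inr_ne_inl (Sum.inl_injective (e.injective ht))
    · obtain ⟨r, -, hr⟩ := Finset.mem_map.1 h
      exact Sum.inr_ne_inl (e.injective hr)
  have hcompl : ∀ z : EuclideanSpace ℝ (Fin n), (∀ i, z (e (.inl (.inl i))) = 0) →
      ∀ i ∉ A, i ∉ W → z i = 0 := by
    intro z hz i hA hW
    obtain ⟨(t | t) | r, rfl⟩ := e.surjective i
    · exact hz t
    · exact absurd (Finset.mem_map_of_mem eA (Finset.mem_univ t)) hA
    · exact absurd (Finset.mem_map_of_mem eW (Finset.mem_univ r)) hW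
  have hΦtend : Tendsto Φ (𝓝 x) (𝓝 0) := by simpa [hΦx] using hΦ.continuousAt.tendsto
  have hU := (P.eventually_mem_feasibleSet_iff hx.feasible).and
    (hφΦ.and ((hΦtend.eventually hΘsign).and (hΦtend.eventually hΘf)))
  have hΘx : ContDiffAt ℝ 1 Θ (Φ x) := by rwa [hΦx]
  have hΘ'x : HasFDerivAt Θ Θ' (Φ x) := by rwa [hΦx]
  obtain ⟨Ψ, hΨ, hxΨ, hΨU, hΨ1, hΨ2⟩ := exists_openPartialHomeomorph_of_injective
    (F := fun z => Θ (Φ z)) (m := 1) (by norm_num) (by decide)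
    (hΘx.comp x (hΦ.of_le (by norm_num))) (hΘ'x.comp x hΦ')
    (hΘ'inj.comp hΦ'inj) hU
  have hmem : ∀ z ∈ Ψ.source, z ∈ P.feasibleSet ↔ Ψ z ∈ P.localModel x := by
    intro z hz
    obtain ⟨h1, -, h3, -⟩ := hΨU hz
    have hs : ∀ t, SignType.sign (Ψ z (e (.inl (.inr t)))) =
        SignType.sign (P.activeConstraint x (.inr t) z) := fun t => by
      rw [hΨ, ← hΦG]
      exact h3 _ (Finset.mem_map_of_mem eA (Finset.mem_univ t))
    rw [h1, hmodel]
    refine and_congr (forall_congr' fun i => ?_) (and_congr (forall_congr' fun j => ?_)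
      (forall_congr' fun m => ?_))
    · rw [hΨ, hΘfix', hΦG]
    · exact MPOC.nonneg_congr_sign (hs _).symm
    · exact MPOC.orthogonalitySet_congr_sign (hs _).symm (hs _).symm
  refine ⟨Ψ, hxΨ, by rw [hΨ, hΦx, hΘ0], hΨ1, hΨ2, ?_,
    fun l => if 0 < Λ.rho₁ (e₀.symm l) then 1 else -1,
    fun r => if ev r < 0 then -1 else 1, ?_, ?_⟩
  · ext y
    constructor
    · rintro ⟨z, ⟨hzM, hz⟩, rfl⟩
      exact ⟨(hmem z hz).1 hzM, Ψ.map_source hz⟩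
    · rintro ⟨hy, hyt⟩
      refine ⟨Ψ.symm y, ⟨(hmem _ (Ψ.map_target hyt)).2 ?_, Ψ.map_target hyt⟩, Ψ.right_inv hyt⟩
      rwa [Ψ.right_inv hyt]
  · rintro y ⟨hy, hyt⟩
    have hz := Ψ.map_target hyt
    obtain ⟨-, h2, -, h4⟩ := hΨU hz
    have hΘy : Θ (Φ (Ψ.symm y)) = y := by rw [← hΨ, Ψ.right_inv hyt]
    have h5 := h4 (hcompl _ fun i => by
      rw [← hΘfix', hΘy]
      exact ((hmodel y).1 hy).1 i)
    rw [h2, hφ0, hΘy] at h5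
    rw [h5, hnormal, Finset.sum_map, Finset.sum_map, Fintype.sum_sum_type,
      Fintype.sum_prod_type, ← add_assoc]
    congr 1
    · congr 1
      · congr 1
        refine Finset.sum_congr rfl fun j _ => ?_
        change ((SignType.sign (fderiv ℝ (fun y => P.f (φ y)) 0
          (EuclideanSpace.single (e (.inl (.inr (.inl j)))) 1)) : SignType) : ℝ) *
            y (e (.inl (.inr (.inl j)))) = _
        rw [hd₁, show Λ.toFun (.inr (.inl j)) = Λ.mu j from rfl, sign_pos (hx.mu_pos j)]
        simp
      · refine Finset.sum_congr rfl fun m _ => ?_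
        rw [Fin.sum_univ_two]
        change ((SignType.sign (fderiv ℝ (fun y => P.f (φ y)) 0
          (EuclideanSpace.single (e (.inl (.inr (.inr (m, 0))))) 1)) : SignType) : ℝ) *
            y (e (.inl (.inr (.inr (m, 0))))) +
          ((SignType.sign (fderiv ℝ (fun y => P.f (φ y)) 0
          (EuclideanSpace.single (e (.inl (.inr (.inr (m, 1))))) 1)) : SignType) : ℝ) *
            y (e (.inl (.inr (.inr (m, 1))))) = _
        rw [hd₁, hd₁, show Λ.toFun (.inr (.inr (m, 0))) = Λ.rho₁ m from rfl,
          show Λ.toFun (.inr (.inr (m, 1))) = Λ.rho₂ m from rfl, sign_neg (hx.rho_ne m).2,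
          Equiv.symm_apply_apply]
        rcases (hx.rho_ne m).1.lt_or_gt with h | h
        · simp [h, h.not_gt]; ring
        · simp [h]; ring
    · refine Finset.sum_congr rfl fun r _ => ?_
      change ((SignType.sign (d (e (.inr r))) : SignType) : ℝ) * y (e (.inr r)) ^ 2 = _
      rw [hdr]
      rcases (hev r).lt_or_gt with h | h
      · rw [sign_neg (by linarith)]; simp [h]
      · rw [sign_pos (by linarith)]; simp [h.not_gt]
  · have hδ : ∀ r, (if ev r < 0 then (-1 : ℤˣ) else 1) = -1 ↔ ev r < 0 := fun r => by
      split_ifs with h <;> simp [h]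
    rw [P.quadraticIndex_eq_card, Finset.filter_congr fun r _ => hδ r]
    refine Finset.card_bij (fun r _ => (finCongr hp).symm r) ?_ ?_ ?_
    · intro r hr; simpa [ev] using hr
    · intro r _ r' _ h; simpa using h
    · intro r hr
      exact ⟨finCongr hp r, by simpa [ev] using hr, by simp⟩
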